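/- Let $e,h,f$ be the standard basis of $\mathfrak{sl}_2(\mathbb{C})$, $\mathfrak{h}=\mathbb{C}h$, and let $\kappa(x,y)=\operatorname{tr}(xy)$. Let $\omega\in\mathfrak{h}^*$ be the fundamental weight ($\omega(h)=1$), $\alpha=2\omega$ the simple root, $\rho=\omega$ the Weyl vector and $\mathsf{Q}=\mathbb{Z}\alpha$ the root lattice, and let $(\cdot,\cdot)$ be the bilinear form on $\mathfrak{h}^*$ induced by $\kappa$, so that $(\alpha,\alpha)=2$. Let $\widehat{\mathfrak{g}}=\mathfrak{sl}_2\otimes\mathbb{C}[t,t^{-1}]\oplus\mathbb{C}K\oplus\mathbb{C}L_0$ be the affine Kac–Moody algebra, with $x_n=x\otimes t^n$, $[x_m,y_n]=[x,y]_{m+n}+m\,\delta_{m+n,0}\,\kappa(x,y)K$, $K$ central and $[L_0,x_n]=-n\,x_n$, and let $\widehat{\mathfrak{g}}^{\ge}$ be the subalgebra spanned by $K$, $L_0$ and the $x_n$ with $n\ge 0$. Fix a level $\mathsf{k}\in\mathbb{C}$ and a conformal weight $\Delta\in\mathbb{C}$, both arbitrary. For an $\mathfrak{sl}_2$-module $M$,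 the relaxed Verma module of $M$ is $U(\widehat{\mathfrak{g}})\otimes_{U(\widehat{\mathfrak{g}}^{\ge})}M$, where $x_0$ acts on $M$ as $x$, $x_n$ acts as $0$ for $n>0$, $K$ acts as $\mathsf{k}$ and $L_0$ acts as $\Delta$; its space of ground states is $1\otimes M$. Let $\mathcal{L}^+_\mu$ (respectively $\mathcal{L}^-_\mu$) be the simple quotient, i.e. the quotient by the maximal proper submodule, of the relaxed Verma module of the $\mathfrak{sl}_2$-Verma module of highest (respectively lowest) weight $\mu\in\mathfrak{h}^*$. For $q\in\mathbb{C}$ and a coset $\lambda\in\mathfrak{h}^*/\mathsf{Q}$, let $\mathcal{D}_{\lambda;q}$ be the dense $\mathfrak{sl}_2$-module with basis $v_\nu$, $\nu\in\lambda$, and action $$e\,v_\nu=\tfrac12\bigl[q-(\nu,\nu+2\rho)\bigr]v_{\nu+\alpha},\qquad h\,v_\nu=(\nu,\alpha)\,v_\nu,\qquad f\,v_\nu=v_{\nu-\alpha}.$$ Let $\mathcal{E}_{\lambda;q}$ be the quotient of the relaxed Verma module of $\mathcal{D}_{\lambda;q}$ by the sum of all its submodules that have zero intersection with the space of ground states.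 Let $\Lambda_q\subset\mathfrak{h}^*/\mathsf{Q}$ be the set of cosets containing some $\mu$ with $(\mu,\mu+2\rho)=q$. **Proposition.** Suppose that $q\in\mathbb{C}$ satisfies $\sqrt{1+2q}\notin\mathbb{Z}$ and let $\lambda\in\Lambda_q$. Then there is a unique $\mu\in\lambda$ with $(\mu,\mu+2\rho)=q$, and for this $\mu$ there is a short exact sequence of $\widehat{\mathfrak{g}}$-modules $$0\longrightarrow\mathcal{L}^+_\mu\longrightarrow\mathcal{E}_{\lambda;q}\longrightarrow\mathcal{L}^-_{\mu+\alpha}\longrightarrow 0,$$ in which all three modules have the same level $\mathsf{k}$ and the same conformal weight $\Delta$ of ground states. -/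

import Mathlib

open scoped TensorProduct

noncomputable section

namespace RelaxedSl2

attribute [local instance 100] LieRing.ofAssociativeRing

/-! ### Induced modules -/

section Induction

variable {L : Type*} [LieRing L] [LieAlgebra ℂ L] (B : LieSubalgebra ℂ L)
  {M : Type*} [AddCommGroup M] [Module ℂ M] (r : B →ₗ⁅ℂ⁆ Module.End ℂ M)

/-- The left `U(L)`-submodule of `U(L) ⊗ M` generated by the elements `b ⊗ m - 1 ⊗ b m`, where
`b ∈ B` and `m ∈ M`. -/
def indRel : Submodule (UniversalEnvelopingAlgebra ℂ L) (UniversalEnvelopingAlgebra ℂ L ⊗[ℂ] M) :=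
  Submodule.span (UniversalEnvelopingAlgebra ℂ L)
    {t | ∃ (b : B) (m : M), t = UniversalEnvelopingAlgebra.ι ℂ (b : L) ⊗ₜ[ℂ] m
      - (1 : UniversalEnvelopingAlgebra ℂ L) ⊗ₜ[ℂ] (r b m)}

/-- The induced `L`-module `U(L) ⊗_{U(B)} M`, where the Lie subalgebra `B` acts on `M` by `r`. -/
abbrev Ind : Type _ := (UniversalEnvelopingAlgebra ℂ L ⊗[ℂ] M) ⧸ indRel B r

/-- The canonical map `M → U(L) ⊗_{U(B)} M`, `m ↦ 1 ⊗ m`. -/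
def Ind.of : M →ₗ[ℂ] Ind B r :=
  ((indRel B r).mkQ.restrictScalars ℂ).comp
    (TensorProduct.mk ℂ (UniversalEnvelopingAlgebra ℂ L) M 1)

end Induction

/-- The representation of `L` on a left `U(L)`-module. -/
def repOfModule (L : Type*) [LieRing L] [LieAlgebra ℂ L] (V : Type*) [AddCommGroup V] [Module ℂ V]
    [Module (UniversalEnvelopingAlgebra ℂ L) V]
    [IsScalarTower ℂ (UniversalEnvelopingAlgebra ℂ L) V] : L →ₗ⁅ℂ⁆ Module.End ℂ V :=
  (Algebra.lsmul ℂ ℂ V : UniversalEnvelopingAlgebra ℂ L →ₐ[ℂ] Module.End ℂ V).toLieHom.comp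
    (UniversalEnvelopingAlgebra.ι ℂ)

/-- The sum of all proper submodules: the maximal proper submodule, when there is a unique one. -/
def maxProper (R V : Type*) [Ring R] [AddCommGroup V] [Module R V] : Submodule R V :=
  sSup {N | N ≠ ⊤}

/-! ### The Lie algebra `sl₂` and its weights -/

/-- `sl₂(ℂ)`, as traceless matrices. -/
def Sl2 : Type := LieAlgebra.SpecialLinear.sl (Fin 2) ℂ

instance : LieRing Sl2 := inferInstanceAs (LieRing (LieAlgebra.SpecialLinear.sl (Fin 2) ℂ))

instance : LieAlgebra ℂ Sl2 :=
  inferInstanceAs (LieAlgebra ℂ (LieAlgebra.SpecialLinear.sl (Fin 2) ℂ))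

/-- The matrix of an element of `sl₂`. -/
def toMatrix : Sl2 →ₗ[ℂ] Matrix (Fin 2) (Fin 2) ℂ where
  toFun x := Subtype.val x
  map_add' _ _ := rfl
  map_smul' _ _ := rfl

lemma toMatrix_lie (x y : Sl2) :
    toMatrix ⁅x, y⁆ = toMatrix x * toMatrix y - toMatrix y * toMatrix x := rfl

lemma trace_toMatrix (x : Sl2) : (toMatrix x).trace = 0 := Subtype.property x

/-- The basis element `h = diag(1, -1)`. -/
def hElt : Sl2 := (LieAlgebra.SpecialLinear.singleSubSingle 0 1 1 :
  LieAlgebra.SpecialLinear.sl (Fin 2) ℂ)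

lemma toMatrix_hElt : toMatrix hElt = Matrix.single 0 0 1 - Matrix.single 1 1 1 := rfl

/-- The Cartan subalgebra `𝔥 = ℂ h`. -/
abbrev Cartan : Submodule ℂ Sl2 := Submodule.span ℂ {hElt}

/-- `h` as an element of `𝔥`. -/
def hCartan : Cartan := ⟨hElt, Submodule.mem_span_singleton_self hElt⟩

/-- The weight space `𝔥*`. -/
abbrev Weight : Type := Module.Dual ℂ Cartan

/-- The matrix entries of an element of `sl₂`, as linear functionals. -/
def entry (i j : Fin 2) : Sl2 →ₗ[ℂ] ℂ where
  toFun x := toMatrix x i j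
  map_add' _ _ := rfl
  map_smul' _ _ := rfl

/-- The trace form `κ(x, y) = tr(x y)`, which is the invariant form on `sl₂` normalised by
`κ(h, h) = 2` and `κ(e, f) = 1`. -/
def killing : Sl2 →ₗ[ℂ] Sl2 →ₗ[ℂ] ℂ :=
  LinearMap.mk₂ ℂ
    (fun x y => Matrix.trace (toMatrix x * toMatrix y))
    (by intros; simp [add_mul]) (by intros; simp) (by intros; simp [mul_add]) (by intros; simp)

/-- The fundamental weight: `ω(h) = 1`. -/
def fundWeight : Weight := (entry 0 0).comp Cartan.subtype

/-- The simple root `α = 2 ω`. -/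
def simpleRoot : Weight := (2 : ℂ) • fundWeight

/-- The Weyl vector `ρ = ω`. -/
def weylVector : Weight := fundWeight

/-- The bilinear form on `𝔥*` induced from `κ` restricted to `𝔥 = ℂ h`. -/
def bilin (μ ν : Weight) : ℂ := μ hCartan * ν hCartan / killing hElt hElt

/-- The root lattice `ℤ α`. -/
abbrev rootLattice : AddSubgroup Weight := AddSubgroup.zmultiples simpleRoot

/-- The set `Λ_q` of cosets in `𝔥* / ℤ α` containing some `μ` with `(μ, μ + 2 ρ) = q`. -/
def nonSimpleSet (q : ℂ) : Set (Weight ⧸ rootLattice) :=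
  {lam | ∃ μ : Weight, (μ : Weight ⧸ rootLattice) = lam ∧ bilin μ (μ + (2 : ℂ) • weylVector) = q}

lemma entry_lie (x y : Sl2) :
    entry 0 0 ⁅x, y⁆ = entry 0 1 x * entry 1 0 y - entry 0 1 y * entry 1 0 x ∧
    entry 0 1 ⁅x, y⁆ = 2 * (entry 0 0 x * entry 0 1 y - entry 0 0 y * entry 0 1 x) ∧
    entry 1 0 ⁅x, y⁆ = 2 * (entry 0 0 y * entry 1 0 x - entry 0 0 x * entry 1 0 y) := by
  have tr : ∀ z : Sl2, entry 1 1 z = - entry 0 0 z := by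
    intro z
    have := trace_toMatrix z
    rw [Matrix.trace_fin_two] at this
    exact eq_neg_of_add_eq_zero_right this
  have key : ∀ i j, entry i j ⁅x, y⁆ = entry i 0 x * entry 0 j y + entry i 1 x * entry 1 j y
      - (entry i 0 y * entry 0 j x + entry i 1 y * entry 1 j x) := by
    intro i j
    change toMatrix ⁅x, y⁆ i j = _
    rw [toMatrix_lie, Matrix.sub_apply, Matrix.mul_apply, Matrix.mul_apply, Fin.sum_univ_two,
      Fin.sum_univ_two]
    rfl
  simp only [key, tr]
  refine ⟨?_, ?_, ?_⟩ <;> ring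

/-! ### Verma modules for `sl₂` -/

/-- The Borel subalgebra `𝔟⁺ = ℂ h + ℂ e`. -/
def borelPos : LieSubalgebra ℂ Sl2 :=
  { LinearMap.ker (entry 1 0) with
    lie_mem' := by
      intro x y hx hy
      change entry 1 0 x = 0 at hx
      change entry 1 0 y = 0 at hy
      change entry 1 0 ⁅x, y⁆ = 0
      rw [(entry_lie x y).2.2, hx, hy]; ring }

/-- The Borel subalgebra `𝔟⁻ = ℂ h + ℂ f`. -/
def borelNeg : LieSubalgebra ℂ Sl2 :=
  { LinearMap.ker (entry 0 1) with
    lie_mem' := by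
      intro x y hx hy
      change entry 0 1 x = 0 at hx
      change entry 0 1 y = 0 at hy
      change entry 0 1 ⁅x, y⁆ = 0
      rw [(entry_lie x y).2.1, hx, hy]; ring }

/-- The one-dimensional `𝔟⁺`-module on which `h` acts as `μ(h)` and `e` as `0`. -/
def charPos (μ : Weight) : borelPos →ₗ⁅ℂ⁆ Module.End ℂ ℂ where
  toFun x := (entry 0 0 (x : Sl2) * μ hCartan) • LinearMap.id
  map_add' x y := by simp [add_mul, add_smul]
  map_smul' a x := by simp [mul_assoc, mul_smul]
  map_lie' := by
    intro x y
    have hx : entry 1 0 (x : Sl2) = 0 := x.2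
    have hy : entry 1 0 (y : Sl2) = 0 := y.2
    rw [LieSubalgebra.coe_bracket, (entry_lie (x : Sl2) (y : Sl2)).1, hx, hy]
    ext
    simp [LieRing.of_associative_ring_bracket, mul_left_comm, mul_comm]

/-- The one-dimensional `𝔟⁻`-module on which `h` acts as `μ(h)` and `f` as `0`. -/
def charNeg (μ : Weight) : borelNeg →ₗ⁅ℂ⁆ Module.End ℂ ℂ where
  toFun x := (entry 0 0 (x : Sl2) * μ hCartan) • LinearMap.id
  map_add' x y := by simp [add_mul, add_smul]
  map_smul' a x := by simp [mul_assoc, mul_smul]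
  map_lie' := by
    intro x y
    have hx : entry 0 1 (x : Sl2) = 0 := x.2
    have hy : entry 0 1 (y : Sl2) = 0 := y.2
    rw [LieSubalgebra.coe_bracket, (entry_lie (x : Sl2) (y : Sl2)).1, hx, hy]
    ext
    simp [LieRing.of_associative_ring_bracket, mul_left_comm, mul_comm]

/-- The Verma module of `sl₂` of highest weight `μ`. -/
abbrev VermaPos (μ : Weight) : Type := Ind borelPos (charPos μ)

/-- The Verma module of `sl₂` of lowest weight `μ`. -/
abbrev VermaNeg (μ : Weight) : Type := Ind borelNeg (charNeg μ)

/-! ### Dense modules for `sl₂` -/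

/-- The space with basis `v_μ`, where `μ` runs over the coset `lam`. -/
abbrev Dense (lam : Weight ⧸ rootLattice) : Type :=
  {μ : Weight // (μ : Weight ⧸ rootLattice) = lam} →₀ ℂ

/-- Translation of the coset `lam` by `n α`. -/
def shift {lam : Weight ⧸ rootLattice} (n : ℤ)
    (μ : {μ : Weight // (μ : Weight ⧸ rootLattice) = lam}) :
    {μ : Weight // (μ : Weight ⧸ rootLattice) = lam} :=
  ⟨μ.1 + n • simpleRoot, by
    have h : ((n • simpleRoot : Weight) : Weight ⧸ rootLattice) = 0 :=
      (QuotientAddGroup.eq_zero_iff _).2 (AddSubgroup.zsmul_mem_zmultiples simpleRoot n)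
    rw [QuotientAddGroup.mk_add, h, add_zero, μ.2]⟩

/-- The coefficient `γ_μ = (q - (μ, μ + 2 ρ)) / 2`. -/
def gammaCoeff (q : ℂ) (μ : Weight) : ℂ := (q - bilin μ (μ + (2 : ℂ) • weylVector)) / 2

/-- `e v_μ = γ_μ v_{μ + α}`. -/
def denseE (lam : Weight ⧸ rootLattice) (q : ℂ) : Module.End ℂ (Dense lam) :=
  Finsupp.linearCombination ℂ fun μ => Finsupp.single (shift 1 μ) (gammaCoeff q μ.1)

/-- `h v_μ = (μ, α) v_μ`. -/
def denseH (lam : Weight ⧸ rootLattice) : Module.End ℂ (Dense lam) :=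
  Finsupp.linearCombination ℂ fun μ => Finsupp.single μ (bilin μ.1 simpleRoot)

/-- `f v_μ = v_{μ - α}`. -/
def denseF (lam : Weight ⧸ rootLattice) : Module.End ℂ (Dense lam) :=
  Finsupp.linearCombination ℂ fun μ => Finsupp.single (shift (-1) μ) 1

lemma entry_hElt : entry 0 0 hElt = 1 := by
  change toMatrix hElt 0 0 = 1
  rw [toMatrix_hElt]
  simp

lemma killing_hElt : killing hElt hElt = 2 := by
  change Matrix.trace (toMatrix hElt * toMatrix hElt) = 2
  rw [toMatrix_hElt]
  simp [Matrix.trace_fin_two, Matrix.mul_apply, Fin.sum_univ_two]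
  norm_num

lemma fundWeight_h : fundWeight hCartan = 1 := entry_hElt

lemma simpleRoot_h : simpleRoot hCartan = 2 := by
  simp [simpleRoot, fundWeight_h]

lemma shift_h {lam : Weight ⧸ rootLattice} (n : ℤ)
    (μ : {μ : Weight // (μ : Weight ⧸ rootLattice) = lam}) :
    (shift n μ).1 hCartan = μ.1 hCartan + 2 * n := by
  simp [shift, simpleRoot_h, mul_comm]

lemma bilin_rho (μ : Weight) :
    bilin μ (μ + (2 : ℂ) • weylVector) = μ hCartan * (μ hCartan + 2) / 2 := by
  simp [bilin, killing_hElt, weylVector, fundWeight_h]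

lemma bilin_root (μ : Weight) : bilin μ simpleRoot = μ hCartan := by
  simp [bilin, killing_hElt, simpleRoot_h]

lemma shift_shift {lam : Weight ⧸ rootLattice} (m n : ℤ)
    (μ : {μ : Weight // (μ : Weight ⧸ rootLattice) = lam}) :
    shift m (shift n μ) = shift (n + m) μ := by
  apply Subtype.ext
  simp [shift, add_smul, add_assoc]

lemma shift_zero {lam : Weight ⧸ rootLattice}
    (μ : {μ : Weight // (μ : Weight ⧸ rootLattice) = lam}) : shift 0 μ = μ := by
  apply Subtype.ext
  simp [shift]

lemma dense_comm (lam : Weight ⧸ rootLattice) (q : ℂ) :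
    denseH lam * denseE lam q - denseE lam q * denseH lam = (2 : ℂ) • denseE lam q ∧
    denseE lam q * denseF lam - denseF lam * denseE lam q = denseH lam ∧
    denseH lam * denseF lam - denseF lam * denseH lam = -(2 : ℂ) • denseF lam := by
  refine ⟨?_, ?_, ?_⟩ <;>
  · refine Finsupp.lhom_ext' fun μ => LinearMap.ext_ring ?_
    simp only [LinearMap.comp_apply, Finsupp.lsingle_apply, LinearMap.sub_apply,
      Module.End.mul_apply, LinearMap.smul_apply, denseE, denseF, denseH,
      Finsupp.linearCombination_single, one_smul, Finsupp.smul_single, smul_eq_mul, mul_one,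
      shift_shift, neg_add_cancel, add_neg_cancel, shift_zero, ← Finsupp.single_sub, bilin_root,
      gammaCoeff, bilin_rho, shift_h]
    congr 1
    push_cast
    ring

/-- The dense `sl₂`-module `D_{λ;q}`: the action of `sl₂` on the span of the `v_μ`, `μ ∈ λ`, with
`e`, `h` and `f` acting by `denseE`, `denseH` and `denseF`. -/
def denseRep (lam : Weight ⧸ rootLattice) (q : ℂ) : Sl2 →ₗ⁅ℂ⁆ Module.End ℂ (Dense lam) where
  toFun x := entry 0 0 x • denseH lam + entry 0 1 x • denseE lam q + entry 1 0 x • denseF lam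
  map_add' x y := by simp only [map_add, add_smul]; abel
  map_smul' a x := by simp only [map_smul, smul_eq_mul, mul_smul, smul_add, RingHom.id_apply]
  map_lie' := by
    intro x y
    obtain ⟨h1, h2, h3⟩ := dense_comm lam q
    obtain ⟨e1, e2, e3⟩ := entry_lie x y
    rw [e1, e2, e3, LieRing.of_associative_ring_bracket]
    have h1' : denseH lam * denseE lam q = (2 : ℂ) • denseE lam q + denseE lam q * denseH lam := by
      rw [← h1]; abel
    have h2' : denseE lam q * denseF lam = denseH lam + denseF lam * denseE lam q := by
      rw [← h2]; abel
    have h3' : denseH lam * denseF lam = -(2 : ℂ) • denseF lam + denseF lam * denseH lam := by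
      rw [← h3]; abel
    simp only [add_mul, mul_add, smul_mul_assoc, mul_smul_comm]
    rw [h1', h2', h3']
    module

/-! ### The affine Kac-Moody algebra -/

/-- The underlying space of the affine Kac-Moody algebra `sl₂ ⊗ ℂ[t, t⁻¹] ⊕ ℂ K ⊕ ℂ L₀`. The loop
`∑ₙ xₙ ⊗ tⁿ` is encoded by the finitely supported function `n ↦ xₙ`. -/
@[ext]
structure Affine : Type where
  /-- the component in `sl₂ ⊗ ℂ[t, t⁻¹]` -/
  loop : ℤ →₀ Sl2
  /-- the coefficient of `K` -/
  cK : ℂ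
  /-- the coefficient of `L₀` -/
  cL : ℂ

namespace Affine

/-- `Affine` as a product. -/
def toProd : Affine ≃ (ℤ →₀ Sl2) × ℂ × ℂ where
  toFun x := (x.loop, x.cK, x.cL)
  invFun x := ⟨x.1, x.2.1, x.2.2⟩
  left_inv _ := rfl
  right_inv _ := rfl

instance : AddCommGroup Affine := toProd.addCommGroup
instance : Module ℂ Affine := toProd.module ℂ

@[simp] lemma loop_zero : (0 : Affine).loop = 0 := rfl
@[simp] lemma cK_zero : (0 : Affine).cK = 0 := rfl
@[simp] lemma cL_zero : (0 : Affine).cL = 0 := rfl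
@[simp] lemma loop_add (x y : Affine) : (x + y).loop = x.loop + y.loop := rfl
@[simp] lemma cK_add (x y : Affine) : (x + y).cK = x.cK + y.cK := rfl
@[simp] lemma cL_add (x y : Affine) : (x + y).cL = x.cL + y.cL := rfl
@[simp] lemma loop_smul (a : ℂ) (x : Affine) : (a • x).loop = a • x.loop := rfl
@[simp] lemma cK_smul (a : ℂ) (x : Affine) : (a • x).cK = a * x.cK := rfl
@[simp] lemma cL_smul (a : ℂ) (x : Affine) : (a • x).cL = a * x.cL := rfl

/-- The bracket of `sl₂ ⊗ ℂ[t, t⁻¹]`, with `[xₘ, yₙ] = [x, y]ₘ₊ₙ`. -/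
def loopBracket : (ℤ →₀ Sl2) →ₗ[ℂ] (ℤ →₀ Sl2) →ₗ[ℂ] (ℤ →₀ Sl2) :=
  LinearMap.mk₂ ℂ
    (fun x y => x.sum fun m a => y.sum fun n b => Finsupp.single (m + n) ⁅a, b⁆)
    (by
      intro x x' y
      refine Finsupp.sum_add_index' ?_ ?_
      · simp
      · intro m a a'
        simp [Finsupp.sum_add])
    (by
      intro c x y
      rw [Finsupp.sum_smul_index' (by simp), Finsupp.smul_sum]
      refine Finsupp.sum_congr fun m _ => ?_
      simp [Finsupp.smul_sum])
    (by
      intro x y y'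
      rw [← Finsupp.sum_add]
      refine Finsupp.sum_congr fun m _ => ?_
      exact Finsupp.sum_add_index' (by simp) (by simp))
    (by
      intro c x y
      rw [Finsupp.smul_sum]
      refine Finsupp.sum_congr fun m _ => ?_
      rw [Finsupp.sum_smul_index' (by simp), Finsupp.smul_sum]
      simp)

/-- The derivation `t d/dt` of `sl₂ ⊗ ℂ[t, t⁻¹]`, with `xₙ ↦ n xₙ`. -/
def loopDeriv : (ℤ →₀ Sl2) →ₗ[ℂ] (ℤ →₀ Sl2) :=
  Finsupp.lsum ℂ fun n : ℤ => (n : ℂ) • Finsupp.lsingle n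

/-- The cocycle with `(xₘ, yₙ) ↦ m κ(x, y)` if `m + n = 0` and `0` otherwise. -/
def cocycle : (ℤ →₀ Sl2) →ₗ[ℂ] (ℤ →₀ Sl2) →ₗ[ℂ] ℂ :=
  Finsupp.lsum ℂ fun m : ℤ => (m : ℂ) • killing.compl₂ (Finsupp.lapply (-m))

lemma loopBracket_single (m n : ℤ) (a b : Sl2) :
    loopBracket (Finsupp.single m a) (Finsupp.single n b) = Finsupp.single (m + n) ⁅a, b⁆ := by
  simp [loopBracket]

lemma loopDeriv_single (n : ℤ) (a : Sl2) :
    loopDeriv (Finsupp.single n a) = Finsupp.single n ((n : ℂ) • a) := by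
  simp [loopDeriv]

lemma cocycle_single (m n : ℤ) (a b : Sl2) :
    cocycle (Finsupp.single m a) (Finsupp.single n b) = if m + n = 0 then m * killing a b else 0 := by
  simp only [cocycle, Finsupp.lsum_single, LinearMap.smul_apply, LinearMap.compl₂_apply,
    Finsupp.lapply_apply, Finsupp.single_apply, smul_eq_mul]
  by_cases h : m + n = 0
  · rw [if_pos h, if_pos (by omega)]
  · rw [if_neg h, if_neg (by omega)]; simp

/-- The bracket with `[xₘ, yₙ] = [x, y]ₘ₊ₙ + m δ_{m+n,0} κ(x, y) K`, `[L₀, xₙ] = -n xₙ` and `K`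
central. -/
instance : Bracket Affine Affine where
  bracket x y :=
    { loop := loopBracket x.loop y.loop - x.cL • loopDeriv y.loop + y.cL • loopDeriv x.loop
      cK := cocycle x.loop y.loop
      cL := 0 }

@[simp] lemma loop_lie (x y : Affine) : ⁅x, y⁆.loop =
    loopBracket x.loop y.loop - x.cL • loopDeriv y.loop + y.cL • loopDeriv x.loop := rfl
@[simp] lemma cK_lie (x y : Affine) : ⁅x, y⁆.cK = cocycle x.loop y.loop := rfl
@[simp] lemma cL_lie (x y : Affine) : ⁅x, y⁆.cL = 0 := rfl

lemma killing_comm (a b : Sl2) : killing a b = killing b a :=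
  Matrix.trace_mul_comm (toMatrix a) (toMatrix b)

lemma killing_lie (a b c : Sl2) : killing ⁅a, b⁆ c = killing a ⁅b, c⁆ := by
  change Matrix.trace (toMatrix ⁅a, b⁆ * toMatrix c) = Matrix.trace (toMatrix a * toMatrix ⁅b, c⁆)
  rw [toMatrix_lie, toMatrix_lie, sub_mul, mul_sub, Matrix.trace_sub, Matrix.trace_sub, mul_assoc,
    ← mul_assoc (toMatrix a) (toMatrix c), Matrix.trace_mul_comm (toMatrix a * toMatrix c),
    mul_assoc]

lemma loopBracket_skew (x y : ℤ →₀ Sl2) : loopBracket x y = - loopBracket y x := by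
  have : loopBracket = - loopBracket.flip := by
    refine Finsupp.lhom_ext fun m a => Finsupp.lhom_ext fun n b => ?_
    simp only [LinearMap.neg_apply, LinearMap.flip_apply, loopBracket_single]
    rw [← lie_skew a b, Finsupp.single_neg, add_comm]
  exact DFunLike.congr_fun (DFunLike.congr_fun this x) y

lemma cocycle_skew (x y : ℤ →₀ Sl2) : cocycle x y = - cocycle y x := by
  have : cocycle = - cocycle.flip := by
    refine Finsupp.lhom_ext fun m a => Finsupp.lhom_ext fun n b => ?_
    simp only [LinearMap.neg_apply, LinearMap.flip_apply, cocycle_single]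
    by_cases h : m + n = 0
    · rw [if_pos h, if_pos (by omega), killing_comm a b, show m = -n by omega]
      push_cast; ring
    · rw [if_neg h, if_neg (by omega), neg_zero]
  exact DFunLike.congr_fun (DFunLike.congr_fun this x) y

lemma loopDeriv_loopBracket (x y : ℤ →₀ Sl2) :
    loopDeriv (loopBracket x y) = loopBracket (loopDeriv x) y + loopBracket x (loopDeriv y) := by
  have : loopBracket.compr₂ loopDeriv =
      loopBracket.comp loopDeriv + loopBracket.compl₂ loopDeriv := by
    refine Finsupp.lhom_ext fun m a => Finsupp.lhom_ext fun n b => ?_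
    simp only [LinearMap.compr₂_apply, LinearMap.compl₂_apply, LinearMap.add_apply,
      LinearMap.comp_apply, loopBracket_single, loopDeriv_single, smul_lie, lie_smul,
      ← Finsupp.single_add]
    congr 1
    push_cast
    module
  exact DFunLike.congr_fun (DFunLike.congr_fun this x) y

lemma cocycle_loopDeriv (x y : ℤ →₀ Sl2) :
    cocycle (loopDeriv x) y + cocycle x (loopDeriv y) = 0 := by
  have : cocycle.comp loopDeriv + cocycle.compl₂ loopDeriv = 0 := by
    refine Finsupp.lhom_ext fun m a => Finsupp.lhom_ext fun n b => ?_
    simp only [LinearMap.compl₂_apply, LinearMap.add_apply, LinearMap.zero_apply,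
      LinearMap.comp_apply, cocycle_single, loopDeriv_single, map_smul, LinearMap.smul_apply,
      smul_eq_mul]
    by_cases h : m + n = 0
    · rw [if_pos h, if_pos h, show n = -m by omega]
      push_cast; ring
    · rw [if_neg h, if_neg h, add_zero]
  exact DFunLike.congr_fun (DFunLike.congr_fun this x) y

lemma loopBracket_leibniz (x y z : ℤ →₀ Sl2) : loopBracket x (loopBracket y z) =
    loopBracket (loopBracket x y) z + loopBracket y (loopBracket x z) := by
  induction x using Finsupp.induction_linear with
  | zero => simp
  | add x x' hx hx' => simp only [map_add, LinearMap.add_apply, hx, hx']; abel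
  | single m a =>
    induction y using Finsupp.induction_linear with
    | zero => simp
    | add y y' hy hy' => simp only [map_add, LinearMap.add_apply, hy, hy']; abel
    | single n b =>
      induction z using Finsupp.induction_linear with
      | zero => simp
      | add z z' hz hz' => simp only [map_add, hz, hz']; abel
      | single p c =>
        simp only [loopBracket_single]
        rw [leibniz_lie a b c, Finsupp.single_add, add_assoc m n p, add_left_comm n m p]

lemma cocycle_leibniz (x y z : ℤ →₀ Sl2) : cocycle x (loopBracket y z) =
    cocycle (loopBracket x y) z + cocycle y (loopBracket x z) := by
  induction x using Finsupp.induction_linear with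
  | zero => simp
  | add x x' hx hx' => simp only [map_add, LinearMap.add_apply, hx, hx']; abel
  | single m a =>
    induction y using Finsupp.induction_linear with
    | zero => simp
    | add y y' hy hy' => simp only [map_add, LinearMap.add_apply, hy, hy']; abel
    | single n b =>
      induction z using Finsupp.induction_linear with
      | zero => simp
      | add z z' hz hz' => simp only [map_add, hz, hz']; abel
      | single p c =>
        simp only [loopBracket_single, cocycle_single]
        have h1 : killing ⁅a, b⁆ c = killing a ⁅b, c⁆ := killing_lie a b c
        have h2 : killing b ⁅a, c⁆ = - killing a ⁅b, c⁆ := by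
          rw [← killing_lie b a c, ← lie_skew, map_neg, LinearMap.neg_apply, h1]
        by_cases h : m + n + p = 0
        · rw [if_pos (by omega), if_pos h, if_pos (by omega), h1, h2]
          push_cast; ring
        · rw [if_neg (by omega), if_neg h, if_neg (by omega), add_zero]

instance : LieRing Affine where
  add_lie x y z := by
    ext1 <;> simp only [loop_lie, loop_add, cL_add, cK_add, map_add, LinearMap.add_apply, cK_lie,
      cL_lie, add_zero]
    module
  lie_add x y z := by
    ext1 <;> simp only [loop_lie, loop_add, cL_add, cK_add, map_add, cK_lie,
      cL_lie, add_zero]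
    module
  lie_self x := by
    have h1 : loopBracket x.loop x.loop = 0 := by
      have h := loopBracket_skew x.loop x.loop
      have h' : (2 : ℂ) • loopBracket x.loop x.loop = 0 := by
        rw [two_smul]; nth_rewrite 1 [h]; exact neg_add_cancel _
      exact (smul_eq_zero.1 h').resolve_left two_ne_zero
    have h2 := self_eq_neg.1 (cocycle_skew x.loop x.loop)
    ext1 <;> simp [h1, h2]
  leibniz_lie x y z := by
    have h1 := loopBracket_leibniz x.loop y.loop z.loop
    have h2 := cocycle_leibniz x.loop y.loop z.loop
    have c1 := cocycle_loopDeriv y.loop z.loop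
    have c2 := cocycle_loopDeriv x.loop z.loop
    have c3 := cocycle_loopDeriv x.loop y.loop
    have c4 := cocycle_skew (loopDeriv x.loop) y.loop
    ext1
    · simp only [loop_lie, loop_add, cL_lie, map_add, map_sub, map_smul, LinearMap.add_apply,
        LinearMap.sub_apply, LinearMap.smul_apply, h1, loopDeriv_loopBracket,
        loopBracket_skew y.loop (loopDeriv x.loop)]
      module
    · simp only [loop_lie, cK_lie, cK_add, map_add, map_sub, map_smul, LinearMap.add_apply,
        LinearMap.sub_apply, LinearMap.smul_apply, h2, smul_eq_mul]
      linear_combination x.cL * c1 - y.cL * c2 + z.cL * (c3 - c4)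
    · simp

instance : LieAlgebra ℂ Affine where
  lie_smul a x y := by
    ext1 <;> simp only [loop_lie, loop_smul, cL_smul, cK_smul, map_smul, cK_lie, cL_lie, mul_zero,
      smul_eq_mul]
    module

lemma loopDeriv_apply (x : ℤ →₀ Sl2) (p : ℤ) : loopDeriv x p = (p : ℂ) • x p := by
  induction x using Finsupp.induction_linear with
  | zero => simp
  | add x x' hx hx' => simp [hx, hx']
  | single m a =>
    rw [loopDeriv_single, Finsupp.single_apply, Finsupp.single_apply]
    split_ifs with h
    · rw [h]
    · simp

lemma loopBracket_apply (x y : ℤ →₀ Sl2) (p : ℤ) :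
    loopBracket x y p = x.sum fun m a => ⁅a, y (p - m)⁆ := by
  rw [loopBracket, LinearMap.mk₂_apply, Finsupp.sum_apply]
  refine Finsupp.sum_congr fun m _ => ?_
  generalize x m = a
  induction y using Finsupp.induction_linear with
  | zero => simp
  | add y y' hy hy' =>
    rw [Finsupp.sum_add_index' (by simp) (by simp), Finsupp.add_apply, hy, hy', Finsupp.add_apply,
      lie_add]
  | single n b =>
    rw [Finsupp.sum_single_index (by simp), Finsupp.single_apply, Finsupp.single_apply]
    by_cases h : m + n = p
    · rw [if_pos h, if_pos (by omega)]
    · rw [if_neg h, if_neg (by omega), lie_zero]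

lemma loopBracket_nonneg {x y : ℤ →₀ Sl2} (hx : ∀ n < 0, x n = 0) (hy : ∀ n < 0, y n = 0) :
    (∀ n < 0, loopBracket x y n = 0) ∧ loopBracket x y 0 = ⁅x 0, y 0⁆ := by
  constructor
  · intro n hn
    rw [loopBracket_apply]
    refine Finset.sum_eq_zero fun m _ => ?_
    by_cases hm : m < 0
    · simp [hx m hm]
    · simp [hy (n - m) (by omega)]
  · rw [loopBracket_apply, Finsupp.sum_of_support_subset (s := insert 0 x.support) _
      (Finset.subset_insert _ _) _ (by simp), Finset.sum_eq_single_of_mem 0 (by simp)]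
    · simp
    · intro m _ hm
      by_cases hm' : m < 0
      · simp [hx m hm']
      · simp [hy (-m) (by omega)]

lemma cocycle_nonneg {x y : ℤ →₀ Sl2} (hx : ∀ n < 0, x n = 0) (hy : ∀ n < 0, y n = 0) :
    cocycle x y = 0 := by
  rw [cocycle, Finsupp.lsum_apply, Finsupp.sum, LinearMap.sum_apply]
  refine Finset.sum_eq_zero fun m _ => ?_
  simp only [LinearMap.smul_apply, LinearMap.compl₂_apply, Finsupp.lapply_apply, smul_eq_mul]
  rcases lt_trichotomy m 0 with h | h | h
  · simp [hx m h]
  · simp [h]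
  · simp [hy (-m) (by omega)]

/-- The subalgebra `ĝ^≥` spanned by `K`, `L₀` and the `xₙ` with `x ∈ sl₂` and `n ≥ 0`. -/
def nonneg : LieSubalgebra ℂ Affine where
  carrier := {x | ∀ n < 0, x.loop n = 0}
  add_mem' := by
    intro x y hx hy n hn
    simp [hx n hn, hy n hn]
  zero_mem' := by
    intro n _
    simp
  smul_mem' := by
    intro a x hx n hn
    simp [hx n hn]
  lie_mem' := by
    intro x y hx hy n hn
    simp [(loopBracket_nonneg hx hy).1 n hn, loopDeriv_apply, hx n hn, hy n hn]

/-- The extension of an `sl₂`-module `M` to a `ĝ^≥`-module: `x₀` acts as `x` does, `xₙ` acts as `0`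
for `n > 0`, and `K` and `L₀` act as multiplication by `k` and `Δ`. -/
def nonnegRep (k Δ : ℂ) {M : Type*} [AddCommGroup M] [Module ℂ M]
    (r : Sl2 →ₗ⁅ℂ⁆ Module.End ℂ M) : nonneg →ₗ⁅ℂ⁆ Module.End ℂ M where
  toFun x := r (x.1.loop 0) + (x.1.cK * k + x.1.cL * Δ) • (1 : Module.End ℂ M)
  map_add' x y := by
    have h : (x + y : nonneg).1 = x.1 + y.1 := rfl
    simp only [h, loop_add, cK_add, cL_add, Finsupp.add_apply, map_add]
    module
  map_smul' a x := by
    have h : (a • x : nonneg).1 = a • x.1 := rfl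
    simp only [h, loop_smul, cK_smul, cL_smul, Finsupp.smul_apply, map_smul,
      RingHom.id_apply]
    module
  map_lie' := by
    intro x y
    have h0 : (⁅x, y⁆ : nonneg).1.loop 0 = ⁅x.1.loop 0, y.1.loop 0⁆ := by
      rw [LieSubalgebra.coe_bracket, loop_lie, Finsupp.add_apply, Finsupp.sub_apply,
        (loopBracket_nonneg x.2 y.2).2]
      simp [loopDeriv_apply]
    have hK : (⁅x, y⁆ : nonneg).1.cK = 0 := cocycle_nonneg x.2 y.2
    have hL : (⁅x, y⁆ : nonneg).1.cL = 0 := rfl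
    rw [h0, hK, hL, LieHom.map_lie, LieRing.of_associative_ring_bracket,
      LieRing.of_associative_ring_bracket]
    simp only [add_mul, mul_add, smul_mul_assoc, mul_smul_comm, one_mul, mul_one]
    module

end Affine

/-! ### Relaxed modules for the affine algebra -/

/-- The universal enveloping algebra of the affine algebra; its left modules are the modules of the
affine algebra. -/
abbrev UAffine : Type := UniversalEnvelopingAlgebra ℂ Affine

/-- The relaxed Verma module of level `k` and conformal weight `Δ` induced from an `sl₂`-module. -/
abbrev RelaxedVerma (k Δ : ℂ) {M : Type*} [AddCommGroup M] [Module ℂ M]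
    (r : Sl2 →ₗ⁅ℂ⁆ Module.End ℂ M) : Type _ :=
  Ind Affine.nonneg (Affine.nonnegRep k Δ r)

/-- The space of ground states of a relaxed Verma module: the image of the inducing module. -/
def groundStates (k Δ : ℂ) {M : Type*} [AddCommGroup M] [Module ℂ M]
    (r : Sl2 →ₗ⁅ℂ⁆ Module.End ℂ M) : Submodule ℂ (RelaxedVerma k Δ r) :=
  LinearMap.range (Ind.of Affine.nonneg (Affine.nonnegRep k Δ r))

/-- The affine Verma module of highest weight `μ`, level `k` and conformal weight `Δ`. -/
abbrev AffineVermaPos (k Δ : ℂ) (μ : Weight) : Type :=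
  RelaxedVerma k Δ (repOfModule Sl2 (VermaPos μ))

/-- The conjugate affine Verma module with ground states of lowest weight `μ`. -/
abbrev AffineVermaNeg (k Δ : ℂ) (μ : Weight) : Type :=
  RelaxedVerma k Δ (repOfModule Sl2 (VermaNeg μ))

/-- `L⁺_μ`: the simple quotient of the affine Verma module `AffineVermaPos`. -/
abbrev SimplePos (k Δ : ℂ) (μ : Weight) : Type :=
  AffineVermaPos k Δ μ ⧸ maxProper UAffine (AffineVermaPos k Δ μ)

/-- `L⁻_μ`: the simple quotient of the affine Verma module `AffineVermaNeg`. -/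
abbrev SimpleNeg (k Δ : ℂ) (μ : Weight) : Type :=
  AffineVermaNeg k Δ μ ⧸ maxProper UAffine (AffineVermaNeg k Δ μ)

/-- The relaxed Verma module induced from the dense module `D_{λ;q}`. -/
abbrev RelaxedDense (k Δ : ℂ) (lam : Weight ⧸ rootLattice) (q : ℂ) : Type :=
  RelaxedVerma k Δ (denseRep lam q)

/-- The sum of the submodules of `RelaxedDense` that meet the space of ground states trivially. -/
def trivialIntersection (k Δ : ℂ) (lam : Weight ⧸ rootLattice) (q : ℂ) :
    Submodule UAffine (RelaxedDense k Δ lam q) :=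
  sSup {N | N.restrictScalars ℂ ⊓ groundStates k Δ (denseRep lam q) = ⊥}

/-- The relaxed highest-weight module `E_{λ;q}` of level `k` and conformal weight `Δ`. -/
abbrev RelaxedE (k Δ : ℂ) (lam : Weight ⧸ rootLattice) (q : ℂ) : Type :=
  RelaxedDense k Δ lam q ⧸ trivialIntersection k Δ lam q

end RelaxedSl2

end

open scoped TensorProduct

noncomputable section

namespace RelaxedSl2

attribute [local instance 100] LieRing.ofAssociativeRing

/-! ### Enveloping algebras -/

section Enveloping

variable {L : Type*} [LieRing L] [LieAlgebra ℂ L]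

local notation "U" => UniversalEnvelopingAlgebra ℂ
local notation "ι" => UniversalEnvelopingAlgebra.ι ℂ

/-! On `𝔰𝔩₂`: with q = (μ, μ+2ρ), the coefficient of e at v_{μ+jα} is −j(μ(h)+j+1). Since (μ(h)+1)²
= 1+2q, the hypothesis on q says that μ(h) is not an integer, so j = 0 is the only integer zero.
Hence the v_{μ−nα}, n ≥ 0, span a submodule isomorphic to the Verma module of highest weight μ, and
the quotient is the one of lowest weight μ+α; both are irreducible (`dense_exact_sequence`).

Inducing gives maps of relaxed Verma modules. The radical, i.e. the sum of the submodules that meet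
the ground states trivially, is the largest submodule of strictly positive relative energy, because
submodules are graded by L₀ (`IsRelaxed.inf_eq_bot_iff`). For irreducible ground states it is the
maximal proper submodule (`maxProper_eq_radical`). Induced maps preserve radicals, and injective
maps of ground states also reflect them, so the maps descend, with the first injective and the
second surjective.

The substance is exactness in the middle. Let Y be the preimage in the relaxed Verma module of D of
the radical on the lowest-weight side. (1) Modulo the radical, e₀ is locally nilpotent on Y
(`comap_radical_le_torsion`). Ground states of Y lie in the highest-weight Verma module. At higher
energy, the positive modes lower the energy, so by induction a large power of e₀ turns a vector of Y
into one annihilated, modulo the radical, by all positive modes; such a vector of positive energy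
lies in the radical. (2) Modulo the image of the first induced map, f₀ is locally nilpotent
everywhere, because it is so on the generating ground states (`torsion_range_eq_top`). So on the
quotient of Y measuring the failure of exactness, both e₀ and f₀ are locally nilpotent while h₀ is
diagonalisable with nonintegral weights; this quotient is zero (`eq_zero_of_locally_nilpotent`).
Neither the level nor Δ plays a role.

The embedding of the ground states in the induced module comes from an explicit action on U(N) ⊗ M
(`actRep`), and the energy bounds from words in negative modes, so no Poincaré–Birkhoff–Witt basis
is needed. -/

lemma subalgebra_eq_top_of_ι_mem (S : Subalgebra ℂ (U L)) (h : ∀ x : L, ι x ∈ S) : S = ⊤ := by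
  let g : L →ₗ⁅ℂ⁆ S :=
    { toFun := fun x => ⟨ι x, h x⟩
      map_add' := fun x y => Subtype.ext (map_add _ _ _)
      map_smul' := fun a x => Subtype.ext (map_smul _ _ _)
      map_lie' := fun {x y} => Subtype.ext (LieHom.map_lie _ x y) }
  -- Uniqueness in the universal property: lifting into S and including back is the identity, so
  -- every u lies in S.
  have : S.val.comp (UniversalEnvelopingAlgebra.lift ℂ g) = AlgHom.id ℂ (U L) := by
    ext x
    simp only [LieHom.coe_comp, Function.comp_apply, AlgHom.coe_toLieHom, AlgHom.comp_apply,
      UniversalEnvelopingAlgebra.lift_ι_apply]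
    rfl
  refine eq_top_iff.2 fun u _ => ?_
  have hu := DFunLike.congr_fun this u
  rw [AlgHom.comp_apply, AlgHom.id_apply] at hu
  rw [← hu]
  exact Subtype.property _

lemma ι_lie_smul {V : Type*} [AddCommGroup V] [Module (U L) V] (x y : L) (v : V) :
    ι ⁅x, y⁆ • v = ι x • ι y • v - ι y • ι x • v := by
  rw [LieHom.map_lie, LieRing.of_associative_ring_bracket, sub_smul, mul_smul, mul_smul]

variable {V : Type*} [AddCommGroup V] [Module ℂ V] [Module (U L) V] [IsScalarTower ℂ (U L) V]

lemma smul_ℂ_comm (u : U L) (a : ℂ) (v : V) : u • a • v = a • u • v := by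
  rw [← algebraMap_smul (U L) a v, ← algebraMap_smul (U L) a (u • v), ← mul_smul, ← mul_smul,
    Algebra.commutes]

/-- The elements of U(L) preserving S form a subalgebra, so it is enough to test generators. -/
lemma smul_mem_of_ι_smul_mem (S : Submodule ℂ V) (h : ∀ (x : L), ∀ v ∈ S, ι x • v ∈ S)
    (u : U L) {v : V} (hv : v ∈ S) : u • v ∈ S := by
  let A : Subalgebra ℂ (U L) :=
    { carrier := {u | ∀ v ∈ S, u • v ∈ S}
      mul_mem' := fun {a b} ha hb v hv => by rw [mul_smul]; exact ha _ (hb _ hv)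
      add_mem' := fun {a b} ha hb v hv => by rw [add_smul]; exact S.add_mem (ha _ hv) (hb _ hv)
      algebraMap_mem' := fun r v hv => by rw [algebraMap_smul]; exact S.smul_mem _ hv }
  have : A = ⊤ := subalgebra_eq_top_of_ι_mem A h
  have hu : u ∈ A := this ▸ Algebra.mem_top
  exact hu v hv

/-- A subspace stable under the action of `L`, as a submodule over `U(L)`. -/
def submoduleOfStable (S : Submodule ℂ V) (h : ∀ (x : L), ∀ v ∈ S, ι x • v ∈ S) :
    Submodule (U L) V :=
  { S with smul_mem' := fun u _ hv => smul_mem_of_ι_smul_mem S h u hv }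

lemma map_smul_of_map_ι_smul {V' : Type*} [AddCommGroup V'] [Module ℂ V']
    (ρ : U L →ₐ[ℂ] Module.End ℂ V') (g : V →ₗ[ℂ] V')
    (h : ∀ (x : L) (v : V), g (ι x • v) = ρ (ι x) (g v)) (u : U L) (v : V) :
    g (u • v) = ρ u (g v) := by
  let A : Subalgebra ℂ (U L) :=
    { carrier := {u | ∀ v, g (u • v) = ρ u (g v)}
      mul_mem' := fun {a b} ha hb v => by rw [mul_smul, ha, hb, map_mul]; rfl
      add_mem' := fun {a b} ha hb v => by rw [add_smul, map_add, ha, hb, map_add]; rfl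
      algebraMap_mem' := fun r v => by
        rw [algebraMap_smul, map_smul, AlgHom.commutes, Module.algebraMap_end_apply] }
  have : A = ⊤ := subalgebra_eq_top_of_ι_mem A h
  have hu : u ∈ A := this ▸ Algebra.mem_top
  exact hu v

/-- A linear map which intertwines the actions of `L` is linear over `U(L)`. -/
def linearOfIntertwines {V' : Type*} [AddCommGroup V'] [Module ℂ V'] [Module (U L) V']
    [IsScalarTower ℂ (U L) V'] (g : V →ₗ[ℂ] V') (h : ∀ (x : L) (v : V), g (ι x • v) = ι x • g v) :
    V →ₗ[U L] V' :=
  { g with map_smul' := fun u v => map_smul_of_map_ι_smul (Algebra.lsmul ℂ ℂ V') g h u v }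

end Enveloping

/-! ### The universal property of induced modules -/

section Induced

local notation "U" => UniversalEnvelopingAlgebra ℂ
local notation "ι" => UniversalEnvelopingAlgebra.ι ℂ

variable {L : Type*} [LieRing L] [LieAlgebra ℂ L] {B : LieSubalgebra ℂ L}
  {M : Type*} [AddCommGroup M] [Module ℂ M] {r : B →ₗ⁅ℂ⁆ Module.End ℂ M}

namespace Ind

lemma ι_smul_of (b : B) (m : M) : ι (b : L) • of B r m = of B r (r b m) := by
  change (indRel B r).mkQ (ι (b : L) • ((1 : U L) ⊗ₜ[ℂ] m)) = (indRel B r).mkQ _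
  rw [← sub_eq_zero, ← map_sub, Submodule.mkQ_apply, Submodule.Quotient.mk_eq_zero]
  refine Submodule.subset_span ⟨b, m, ?_⟩
  rw [TensorProduct.smul_tmul', smul_eq_mul, mul_one]
  rfl

lemma mkQ_tmul (u : U L) (m : M) : (indRel B r).mkQ (u ⊗ₜ[ℂ] m) = u • of B r m := by
  change _ = (indRel B r).mkQ (u • ((1 : U L) ⊗ₜ[ℂ] m))
  rw [TensorProduct.smul_tmul', smul_eq_mul, mul_one]

lemma span_range_of : Submodule.span (U L) (Set.range (of B r)) = ⊤ := by
  refine eq_top_iff.2 fun v _ => ?_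
  obtain ⟨t, rfl⟩ := (indRel B r).mkQ_surjective v
  induction t with
  | zero => rw [map_zero]; exact Submodule.zero_mem _
  | add s t hs ht => rw [map_add]; exact Submodule.add_mem _ (hs trivial) (ht trivial)
  | tmul u m => rw [mkQ_tmul]; exact Submodule.smul_mem _ _ (Submodule.subset_span ⟨m, rfl⟩)

section LiftRep

variable {V : Type*} [AddCommGroup V] [Module ℂ V] (ρ : L →ₗ⁅ℂ⁆ Module.End ℂ V)
  (g : M →ₗ[ℂ] V)

/-- The map `u ⊗ m ↦ u g(m)`. -/
def liftTensor : U L ⊗[ℂ] M →ₗ[ℂ] V :=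
  TensorProduct.lift ((LinearMap.lcomp ℂ V g).comp
    (UniversalEnvelopingAlgebra.lift ℂ ρ).toLinearMap)

lemma liftTensor_tmul (u : U L) (m : M) :
    liftTensor ρ g (u ⊗ₜ[ℂ] m) = UniversalEnvelopingAlgebra.lift ℂ ρ u (g m) := rfl

lemma liftTensor_smul (u : U L) (t : U L ⊗[ℂ] M) :
    liftTensor ρ g (u • t) = UniversalEnvelopingAlgebra.lift ℂ ρ u (liftTensor ρ g t) := by
  induction t with
  | zero => simp
  | add s t hs ht => simp only [smul_add, map_add, hs, ht]
  | tmul u' m =>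
    rw [TensorProduct.smul_tmul', smul_eq_mul, liftTensor_tmul, liftTensor_tmul, map_mul]
    rfl

lemma liftTensor_eq_zero (h : ∀ (b : B) (m : M), g (r b m) = ρ b (g m))
    {t : U L ⊗[ℂ] M} (ht : t ∈ indRel B r) : liftTensor ρ g t = 0 := by
  induction ht using Submodule.span_induction with
  | zero => simp
  | add s t _ _ hs ht => rw [map_add, hs, ht, add_zero]
  | smul u t _ ht => rw [liftTensor_smul, ht, map_zero]
  | mem t ht =>
    obtain ⟨b, m, rfl⟩ := ht
    rw [map_sub, liftTensor_tmul, liftTensor_tmul, UniversalEnvelopingAlgebra.lift_ι_apply,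
      map_one, Module.End.one_apply, h, sub_self]

/-- The extension of a map intertwining the actions of `B` to the induced module. -/
def liftRep (h : ∀ (b : B) (m : M), g (r b m) = ρ b (g m)) : Ind B r →ₗ[ℂ] V :=
  Submodule.liftQ ((indRel B r).restrictScalars ℂ) (liftTensor ρ g)
    (fun _ ht => liftTensor_eq_zero ρ g h ht)

variable (h : ∀ (b : B) (m : M), g (r b m) = ρ b (g m))

lemma liftRep_of (m : M) : liftRep ρ g h (of B r m) = g m := by
  change UniversalEnvelopingAlgebra.lift ℂ ρ 1 (g m) = g m
  rw [map_one, Module.End.one_apply]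

lemma liftRep_ι_smul (x : L) (v : Ind B r) : liftRep ρ g h (ι x • v) = ρ x (liftRep ρ g h v) := by
  obtain ⟨t, rfl⟩ := (indRel B r).mkQ_surjective v
  rw [← map_smul]
  change liftTensor ρ g (ι x • t) = ρ x (liftTensor ρ g t)
  rw [liftTensor_smul, UniversalEnvelopingAlgebra.lift_ι_apply]

end LiftRep

end Ind

end Induced

/-! ### The inducing module embeds into the induced module -/

section Complement

local notation "U" => UniversalEnvelopingAlgebra ℂ
local notation "ι" => UniversalEnvelopingAlgebra.ι ℂ

variable {L : Type*} [LieRing L] [LieAlgebra ℂ L] {N B : LieSubalgebra ℂ L}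
  (hNB : IsCompl N.toSubmodule B.toSubmodule)
  {M : Type*} [AddCommGroup M] [Module ℂ M] (r : B →ₗ⁅ℂ⁆ Module.End ℂ M)

/-- The natural action of a subalgebra `N` on `Hom(L, W)`, where `W` is an `N`-module. -/
def homRep (N : LieSubalgebra ℂ L) (W : Type*) [AddCommGroup W] [Module ℂ W] [Module (U N) W]
    [IsScalarTower ℂ (U N) W] : N →ₗ⁅ℂ⁆ Module.End ℂ (L →ₗ[ℂ] W) where
  toFun y := LinearMap.llcomp ℂ L W W (repOfModule N W y)
    - LinearMap.lcomp ℂ W (LieAlgebra.ad ℂ L (y : L))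
  map_add' y y' := by
    ext G l
    simp
    abel
  map_smul' a y := by
    ext G l
    simp [smul_sub]
  map_lie' := by
    intro y y'
    ext G l
    simp only [LieRing.of_associative_ring_bracket, LieHom.map_lie, LinearMap.sub_apply,
      LinearMap.llcomp_apply, LinearMap.lcomp_apply, LieAlgebra.ad_apply, Module.End.mul_apply,
      map_sub, LieSubalgebra.coe_bracket]
    abel

lemma homRep_apply (N : LieSubalgebra ℂ L) (W : Type*) [AddCommGroup W] [Module ℂ W]
    [Module (U N) W] [IsScalarTower ℂ (U N) W] (y : N) (G : L →ₗ[ℂ] W) (l : L) :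
    homRep N W y G l = ι y • G l - G ⁅(y : L), l⁆ := rfl

/-- The projection to the first of two complementary subalgebras. -/
def compProj : L →ₗ[ℂ] N := N.toSubmodule.projectionOnto B.toSubmodule hNB

lemma compProj_left (y : N) : compProj hNB (y : L) = y :=
  Submodule.projectionOnto_apply_left hNB y

lemma compProj_right (b : B) : compProj hNB (b : L) = 0 :=
  Submodule.projectionOnto_apply_right hNB b

/-- The map `m ↦ (n + b ↦ n ⊗ m + 1 ⊗ b m)`. -/
def actOne : M →ₗ[ℂ] L →ₗ[ℂ] U N ⊗[ℂ] M :=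
  (LinearMap.lcomp ℂ (U N ⊗[ℂ] M)
      ((ι : N →ₗ⁅ℂ⁆ U N).toLinearMap.comp (compProj hNB))).comp
    (TensorProduct.mk ℂ (U N) M).flip +
  ((TensorProduct.mk ℂ (U N) M 1).compRight ℂ).comp
    ((r.toLinearMap.comp (compProj hNB.symm)).flip)

lemma actOne_left (m : M) (y : N) : actOne hNB r m (y : L) = ι y ⊗ₜ[ℂ] m := by
  change ι (compProj hNB (y : L)) ⊗ₜ[ℂ] m + (1 : U N) ⊗ₜ[ℂ] (r (compProj hNB.symm (y : L)) m) = _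
  rw [compProj_left, compProj_right, map_zero, LinearMap.zero_apply, TensorProduct.tmul_zero,
    add_zero]

lemma actOne_right (m : M) (b : B) : actOne hNB r m (b : L) = (1 : U N) ⊗ₜ[ℂ] (r b m) := by
  change ι (compProj hNB (b : L)) ⊗ₜ[ℂ] m + (1 : U N) ⊗ₜ[ℂ] (r (compProj hNB.symm (b : L)) m) = _
  rw [compProj_left, compProj_right, map_zero, TensorProduct.zero_tmul, zero_add]

/-- The action of `L` on `U(N) ⊗ M`, as a linear map. -/
def actLinear : L →ₗ[ℂ] Module.End ℂ (U N ⊗[ℂ] M) :=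
  (TensorProduct.lift ((LinearMap.lcomp ℂ _ (actOne hNB r)).comp
    (UniversalEnvelopingAlgebra.lift ℂ (homRep N (U N ⊗[ℂ] M))).toLinearMap)).flip

/-- A vector w is encoded by the function l ↦ l w on L. The wanted rule l (y w) = y (l w) − [y, l] w
says that replacing w by y w applies `homRep` to this function. Letting u act through `homRep` on
the function of 1 ⊗ m therefore defines the action with no choice of basis. -/
lemma actLinear_tmul (l : L) (u : U N) (m : M) : actLinear hNB r l (u ⊗ₜ[ℂ] m) =
    UniversalEnvelopingAlgebra.lift ℂ (homRep N (U N ⊗[ℂ] M)) u (actOne hNB r m) l := rfl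

lemma actLinear_one (l : L) (m : M) : actLinear hNB r l ((1 : U N) ⊗ₜ[ℂ] m) =
    actOne hNB r m l := by
  rw [actLinear_tmul, map_one, Module.End.one_apply]

lemma actLinear_ι_smul (l : L) (y : N) (w : U N ⊗[ℂ] M) : actLinear hNB r l (ι y • w) =
    ι y • actLinear hNB r l w - actLinear hNB r ⁅(y : L), l⁆ w := by
  induction w with
  | zero => simp
  | add w w' h h' => simp only [smul_add, map_add, h, h']; abel
  | tmul u m =>
    rw [TensorProduct.smul_tmul', smul_eq_mul, actLinear_tmul, map_mul, Module.End.mul_apply,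
      UniversalEnvelopingAlgebra.lift_ι_apply, homRep_apply]
    rfl

lemma tensor_induction {P : U N ⊗[ℂ] M → Prop} (one : ∀ m, P ((1 : U N) ⊗ₜ[ℂ] m))
    (add : ∀ w w', P w → P w' → P (w + w')) (smul : ∀ (a : ℂ) w, P w → P (a • w))
    (ι_smul : ∀ (y : N) w, P w → P (ι y • w)) (w : U N ⊗[ℂ] M) : P w := by
  let S : Submodule ℂ (U N ⊗[ℂ] M) :=
    { carrier := {w | P w}
      add_mem' := fun {w w'} h h' => add w w' h h'
      zero_mem' := by simpa using smul 0 _ (one 0)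
      smul_mem' := fun a w h => smul a w h }
  induction w with
  | zero => exact S.zero_mem
  | add w w' h h' => exact add w w' h h'
  | tmul u m =>
    have := smul_mem_of_ι_smul_mem S (fun y w h => ι_smul y w h) u (v := 1 ⊗ₜ m) (one m)
    rwa [TensorProduct.smul_tmul', smul_eq_mul, mul_one] at this

lemma actLinear_left (y : N) (w : U N ⊗[ℂ] M) : actLinear hNB r (y : L) w = ι y • w := by
  induction w using tensor_induction generalizing y with
  | one m => rw [actLinear_one, actOne_left, TensorProduct.smul_tmul', smul_eq_mul, mul_one]
  | add w w' h h' => rw [map_add, h, h', smul_add]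
  | smul a w h => rw [map_smul, h, smul_ℂ_comm]
  | ι_smul y' w h =>
    -- The induction hypothesis is used twice, for y and for [y', y], which is why y is generalised.
    rw [actLinear_ι_smul, h, ← LieSubalgebra.coe_bracket, h, ι_lie_smul]
    abel

lemma actLinear_lie_left (l : L) (y : N) (w : U N ⊗[ℂ] M) : actLinear hNB r ⁅l, (y : L)⁆ w =
    actLinear hNB r l (actLinear hNB r (y : L) w) -
      actLinear hNB r (y : L) (actLinear hNB r l w) := by
  rw [actLinear_left, actLinear_left, actLinear_ι_smul, ← lie_skew, map_neg, LinearMap.neg_apply]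
  abel

lemma exists_add_of_isCompl (hNB : IsCompl N.toSubmodule B.toSubmodule) (l : L) :
    ∃ (y : N) (b : B), l = y + b := by
  have : l ∈ N.toSubmodule ⊔ B.toSubmodule := hNB.sup_eq_top ▸ Submodule.mem_top
  obtain ⟨y, hy, b, hb, h⟩ := Submodule.mem_sup.1 this
  exact ⟨⟨y, hy⟩, ⟨b, hb⟩, h.symm⟩

/-- Split both arguments along N ⊕ B. The pairs with an entry in N are covered by
`actLinear_lie_left`, up to skew symmetry; the pair in B is the fact that r is a representation. -/
lemma actLinear_lie_one (l l' : L) (m : M) : actLinear hNB r ⁅l, l'⁆ ((1 : U N) ⊗ₜ[ℂ] m) =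
    actLinear hNB r l (actLinear hNB r l' (1 ⊗ₜ[ℂ] m)) -
      actLinear hNB r l' (actLinear hNB r l (1 ⊗ₜ[ℂ] m)) := by
  obtain ⟨y, b, rfl⟩ := exists_add_of_isCompl hNB l
  obtain ⟨y', b', rfl⟩ := exists_add_of_isCompl hNB l'
  have hb : actLinear hNB r ⁅(b : L), (b' : L)⁆ ((1 : U N) ⊗ₜ[ℂ] m) =
      actLinear hNB r b (actLinear hNB r b' (1 ⊗ₜ[ℂ] m)) -
      actLinear hNB r b' (actLinear hNB r b (1 ⊗ₜ[ℂ] m)) := by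
    rw [← LieSubalgebra.coe_bracket]
    simp only [actLinear_one, actOne_right]
    rw [LieHom.map_lie, LieRing.of_associative_ring_bracket, LinearMap.sub_apply,
      TensorProduct.tmul_sub]
    rfl
  have h1 := actLinear_lie_left hNB r b y' (1 ⊗ₜ[ℂ] m)
  have h2 := actLinear_lie_left hNB r b' y (1 ⊗ₜ[ℂ] m)
  have h3 := actLinear_lie_left hNB r y y' (1 ⊗ₜ[ℂ] m)
  rw [← lie_skew, map_neg, LinearMap.neg_apply, neg_eq_iff_eq_neg] at h2
  simp only [add_lie, lie_add, map_add, LinearMap.add_apply, hb, h1, h2, h3]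
  abel

/-- If `L = N ⊕ B`, then the action of `B` on `M` extends to an action of `L` on `U(N) ⊗ M`. -/
def actRep : L →ₗ⁅ℂ⁆ Module.End ℂ (U N ⊗[ℂ] M) where
  __ := actLinear hNB r
  map_lie' := by
    intro l l'
    refine LinearMap.ext fun w => ?_
    change actLinear hNB r ⁅l, l'⁆ w =
      actLinear hNB r l (actLinear hNB r l' w) - actLinear hNB r l' (actLinear hNB r l w)
    induction w using tensor_induction generalizing l l' with
    | one m => exact actLinear_lie_one hNB r l l' m
    | add w w' h h' => simp only [map_add, h, h']; abel
    | smul a w h => simp only [map_smul, h, smul_sub]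
    -- Moving y to the left produces the brackets of (l, l'), ([y, l], l') and (l, [y, l']) acting
    -- on w; the Jacobi identity matches them, so the hypothesis must hold for all l and l'.
    | ι_smul y w h =>
      have jacobi : ⁅(y : L), ⁅l, l'⁆⁆ = ⁅⁅(y : L), l⁆, l'⁆ + ⁅l, ⁅(y : L), l'⁆⁆ :=
        leibniz_lie _ _ _
      simp only [actLinear_ι_smul, jacobi, map_add, map_sub, LinearMap.add_apply, h, smul_sub]
      abel

/-- If `L = N ⊕ B`, then the inducing `B`-module embeds into the induced `L`-module. -/
lemma Ind.of_injective (hNB : IsCompl N.toSubmodule B.toSubmodule)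
    (r : B →ₗ⁅ℂ⁆ Module.End ℂ M) : Function.Injective (Ind.of B r) := by
  let g : M →ₗ[ℂ] U N ⊗[ℂ] M := TensorProduct.mk ℂ (U N) M 1
  have hg : ∀ (b : B) (m : M), g (r b m) = actRep hNB r b (g m) := fun b m =>
    ((actLinear_one hNB r b m).trans (actOne_right hNB r m b)).symm
  -- The zero character extends to the augmentation of U(N), which gives a left inverse of m ↦ 1 ⊗
  -- m.
  let ε : U N ⊗[ℂ] M →ₗ[ℂ] M := TensorProduct.lift ((LinearMap.lsmul ℂ M).comp
    (UniversalEnvelopingAlgebra.lift ℂ (0 : N →ₗ⁅ℂ⁆ ℂ)).toLinearMap)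
  refine Function.LeftInverse.injective (g := fun v => ε (Ind.liftRep (actRep hNB r) g hg v)) ?_
  intro m
  change ε (Ind.liftRep (actRep hNB r) g hg (Ind.of B r m)) = m
  rw [Ind.liftRep_of]
  change UniversalEnvelopingAlgebra.lift ℂ (0 : N →ₗ⁅ℂ⁆ ℂ) 1 • m = m
  rw [map_one, one_smul]

end Complement

/-! ### Eigenspaces and stable subspaces -/

section Eigenspaces

variable {V : Type*} [AddCommGroup V] [Module ℂ V] {I : Type*} {c : I → ℂ}

/-- T − c_a kills the term with index a and rescales each of the others by a nonzero factor, so the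
number of terms drops. -/
lemma mem_of_sum_eigenvectors_mem {T : Module.End ℂ V} (hc : Function.Injective c)
    {N : Submodule ℂ V} (hN : ∀ v ∈ N, T v ∈ N) (s : Finset I) (w : I → V)
    (hw : ∀ i, w i ∈ T.eigenspace (c i)) (h : ∑ i ∈ s, w i ∈ N) : ∀ i ∈ s, w i ∈ N := by
  classical
  induction s using Finset.induction_on generalizing w with
  | empty => simp
  | insert a s ha ih =>
    rw [Finset.sum_insert ha] at h
    have hT : ∀ i, T (w i) = c i • w i := fun i => Module.End.mem_eigenspace_iff.1 (hw i)
    have h1 : ∑ i ∈ s, (c i - c a) • w i ∈ N := by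
      have := N.sub_mem (hN _ h) (N.smul_mem (c a) h)
      rw [map_add, map_sum, hT, smul_add, Finset.smul_sum, add_sub_add_left_eq_sub,
        ← Finset.sum_sub_distrib] at this
      simpa only [hT, sub_smul] using this
    have h2 : ∀ i ∈ s, w i ∈ N := by
      intro i hi
      have h3 := ih (fun i => (c i - c a) • w i) (fun i => Submodule.smul_mem _ _ (hw i)) h1 i hi
      have hne : c i - c a ≠ 0 := sub_ne_zero.2 fun h => ha (hc h ▸ hi)
      simpa [smul_smul, hne] using N.smul_mem (c i - c a)⁻¹ h3
    intro i hi
    rcases Finset.mem_insert.1 hi with rfl | hi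
    · exact (N.add_mem_iff_left (N.sum_mem h2)).1 h
    · exact h2 i hi

/-- Used twice: with L₀, to grade submodules by energy, and with h₀, to decompose into weights. -/
lemma le_iSup_inf_eigenspace {T : Module.End ℂ V} (hc : Function.Injective c) {N : Submodule ℂ V}
    (hN : ∀ v ∈ N, T v ∈ N) (h : N ≤ ⨆ i, T.eigenspace (c i)) :
    N ≤ ⨆ i, N ⊓ T.eigenspace (c i) := by
  intro v hv
  obtain ⟨w, hw, rfl⟩ := (Submodule.mem_iSup_iff_exists_finsupp _ _).1 (h hv)
  have := mem_of_sum_eigenvectors_mem hc hN w.support w hw hv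
  exact Submodule.sum_mem _ fun i hi =>
    Submodule.mem_iSup_of_mem i (Submodule.mem_inf.2 ⟨this i hi, hw i⟩)

end Eigenspaces

/-! ### The standard basis of `sl₂` -/

lemma Sl2.ext_entry {x y : Sl2} (h0 : entry 0 0 x = entry 0 0 y) (h1 : entry 0 1 x = entry 0 1 y)
    (h2 : entry 1 0 x = entry 1 0 y) : x = y := by
  have tr : ∀ z : Sl2, entry 1 1 z = - entry 0 0 z := by
    intro z
    have := trace_toMatrix z
    rw [Matrix.trace_fin_two] at this
    exact eq_neg_of_add_eq_zero_right this
  have h3 : entry 1 1 x = entry 1 1 y := by rw [tr, tr, h0]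
  refine Subtype.ext (Matrix.ext fun i j => ?_)
  fin_cases i <;> fin_cases j
  exacts [h0, h1, h2, h3]

/-- The basis element `e` of `sl₂`. -/
def eElt : Sl2 := (LieAlgebra.SpecialLinear.single 0 1 (by decide) 1 :
  LieAlgebra.SpecialLinear.sl (Fin 2) ℂ)

/-- The basis element `f` of `sl₂`. -/
def fElt : Sl2 := (LieAlgebra.SpecialLinear.single 1 0 (by decide) 1 :
  LieAlgebra.SpecialLinear.sl (Fin 2) ℂ)

lemma entry_basis : (entry 0 0 hElt = 1 ∧ entry 0 1 hElt = 0 ∧ entry 1 0 hElt = 0) ∧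
    (entry 0 0 eElt = 0 ∧ entry 0 1 eElt = 1 ∧ entry 1 0 eElt = 0) ∧
    (entry 0 0 fElt = 0 ∧ entry 0 1 fElt = 0 ∧ entry 1 0 fElt = 1) := by
  have he : toMatrix eElt = Matrix.single 0 1 1 := rfl
  have hf : toMatrix fElt = Matrix.single 1 0 1 := rfl
  have key : ∀ i j x, entry i j x = toMatrix x i j := fun _ _ _ => rfl
  simp [key, he, hf, toMatrix_hElt]

lemma sl2_eq (x : Sl2) :
    x = entry 0 0 x • hElt + entry 0 1 x • eElt + entry 1 0 x • fElt := by
  obtain ⟨⟨h1, h2, h3⟩, ⟨e1, e2, e3⟩, f1, f2, f3⟩ := entry_basis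
  apply Sl2.ext_entry <;> simp [h1, h2, h3, e1, e2, e3, f1, f2, f3]

lemma lie_h_e : ⁅hElt, eElt⁆ = (2 : ℂ) • eElt := by
  obtain ⟨⟨h1, h2, h3⟩, ⟨e1, e2, e3⟩, f1, f2, f3⟩ := entry_basis
  apply Sl2.ext_entry <;>
    simp [(entry_lie _ _).1, (entry_lie _ _).2.1, (entry_lie _ _).2.2, h1, h2, h3, e1, e2, e3]

lemma lie_h_f : ⁅hElt, fElt⁆ = -((2 : ℂ) • fElt) := by
  obtain ⟨⟨h1, h2, h3⟩, ⟨e1, e2, e3⟩, f1, f2, f3⟩ := entry_basis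
  apply Sl2.ext_entry <;>
    simp [(entry_lie _ _).1, (entry_lie _ _).2.1, (entry_lie _ _).2.2, h1, h2, h3, f1, f2, f3]

lemma lie_e_f : ⁅eElt, fElt⁆ = hElt := by
  obtain ⟨⟨h1, h2, h3⟩, ⟨e1, e2, e3⟩, f1, f2, f3⟩ := entry_basis
  apply Sl2.ext_entry <;>
    simp [(entry_lie _ _).1, (entry_lie _ _).2.1, (entry_lie _ _).2.2, h1, h2, h3, e1, e2, e3,
      f1, f2, f3]

/-- The adjoint weights are −2, 0, 2 and e raises them by 2. This is the source of every exponent 3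
in the torsion arguments. -/
lemma ad_e_pow_three (z : Sl2) : ((LieAlgebra.ad ℂ Sl2 eElt) ^ 3) z = 0 := by
  obtain ⟨⟨h1, h2, h3⟩, ⟨e1, e2, e3⟩, f1, f2, f3⟩ := entry_basis
  apply Sl2.ext_entry <;>
    simp [pow_succ, (entry_lie _ _).1, (entry_lie _ _).2.1, (entry_lie _ _).2.2, e1, e2, e3]

lemma ad_f_pow_three (z : Sl2) : ((LieAlgebra.ad ℂ Sl2 fElt) ^ 3) z = 0 := by
  obtain ⟨⟨h1, h2, h3⟩, ⟨e1, e2, e3⟩, f1, f2, f3⟩ := entry_basis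
  apply Sl2.ext_entry <;>
    simp [pow_succ, (entry_lie _ _).1, (entry_lie _ _).2.1, (entry_lie _ _).2.2, f1, f2, f3]

instance : FiniteDimensional ℂ Sl2 :=
  inferInstanceAs (FiniteDimensional ℂ (LieAlgebra.SpecialLinear.sl (Fin 2) ℂ))

/-! ### The standard generators of the affine algebra -/

namespace Affine

/-- The element `xₙ = x ⊗ tⁿ`, as a linear function of `x`. -/
def mode (n : ℤ) : Sl2 →ₗ[ℂ] Affine where
  toFun x := ⟨Finsupp.single n x, 0, 0⟩
  map_add' x y := by ext1 <;> simp
  map_smul' a x := by ext1 <;> simp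

/-- The central element `K`. -/
def KElt : Affine := ⟨0, 1, 0⟩

/-- The derivation `L₀`. -/
def LElt : Affine := ⟨0, 0, 1⟩

lemma lie_mode_mode (m n : ℤ) (x y : Sl2) : ⁅mode m x, mode n y⁆ =
    mode (m + n) ⁅x, y⁆ + (if m + n = 0 then m * killing x y else 0) • KElt := by
  by_cases h : m + n = 0 <;> ext1 <;> simp [mode, KElt, loopBracket_single, cocycle_single, h]

lemma lie_mode_zero (n : ℤ) (x y : Sl2) : ⁅mode 0 x, mode n y⁆ = mode n ⁅x, y⁆ := by
  rw [lie_mode_mode]; simp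

lemma lie_L_mode (n : ℤ) (x : Sl2) : ⁅LElt, mode n x⁆ = (-(n : ℂ)) • mode n x := by
  ext1 <;> simp [-neg_smul, mode, LElt, loopDeriv_single]
  rw [neg_smul, Finsupp.single_neg]

lemma lie_K (a : Affine) : ⁅KElt, a⁆ = 0 := by
  ext1 <;> simp [KElt]

lemma eq_sum_modes (a : Affine) :
    a = a.loop.sum (fun n x => mode n x) + a.cK • KElt + a.cL • LElt := by
  obtain ⟨l, b, c⟩ := a
  have h : l.sum (fun n x => mode n x) = ⟨l, 0, 0⟩ := by
    induction l using Finsupp.induction_linear with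
    | zero => rw [Finsupp.sum_zero_index]; rfl
    | add x y hx hy =>
      rw [Finsupp.sum_add_index' (by simp) (by simp), hx, hy]
      ext1 <;> simp
    | single n x => rw [Finsupp.sum_single_index (by simp)]; rfl
  rw [h]
  ext1 <;> simp [KElt, LElt]

/-- The subalgebra spanned by the `xₙ` with `n < 0`. -/
def negative : LieSubalgebra ℂ Affine where
  carrier := {x | (∀ n ≥ 0, x.loop n = 0) ∧ x.cK = 0 ∧ x.cL = 0}
  add_mem' := by
    rintro x y ⟨hx, hx', hx''⟩ ⟨hy, hy', hy''⟩
    refine ⟨fun n hn => ?_, ?_, ?_⟩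
    · simp [hx n hn, hy n hn]
    · simp [hx', hy']
    · simp [hx'', hy'']
  zero_mem' := by simp
  smul_mem' := by
    rintro a x ⟨hx, hx', hx''⟩
    refine ⟨fun n hn => ?_, ?_, ?_⟩
    · simp [hx n hn]
    · simp [hx']
    · simp [hx'']
  lie_mem' := by
    rintro x y ⟨hx, hx', hx''⟩ ⟨hy, hy', hy''⟩
    refine ⟨fun n hn => ?_, ?_, rfl⟩
    · have : loopBracket x.loop y.loop n = 0 := by
        rw [loopBracket_apply]
        refine Finset.sum_eq_zero fun m _ => ?_
        by_cases hm : m < 0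
        · simp [hy (n - m) (by omega)]
        · simp [hx m (by omega)]
      simp [this, hx'', hy'']
    · rw [cK_lie, cocycle, Finsupp.lsum_apply, Finsupp.sum, LinearMap.sum_apply]
      refine Finset.sum_eq_zero fun m _ => ?_
      by_cases hm : m < 0
      · simp [hy (-m) (by omega)]
      · simp [hx m (by omega)]

/-- The splitting required by `Ind.of_injective` for ground states to embed. -/
lemma isCompl_negative_nonneg : IsCompl negative.toSubmodule nonneg.toSubmodule := by
  constructor
  · rw [Submodule.disjoint_def]
    rintro x ⟨hx, hK, hL⟩ (hx' : ∀ n < 0, x.loop n = 0)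
    ext1
    · ext1 n
      rcases lt_or_ge n 0 with h | h
      · exact hx' n h
      · exact hx n h
    · exact hK
    · exact hL
  · rw [codisjoint_iff, eq_top_iff]
    intro x _
    refine Submodule.mem_sup.2 ⟨⟨x.loop.filter (· < 0), 0, 0⟩, ⟨?_, rfl, rfl⟩,
      ⟨x.loop.filter (fun n => ¬ n < 0), x.cK, x.cL⟩, ?_, ?_⟩
    · intro n hn
      exact Finsupp.filter_apply_neg _ _ (by omega)
    · intro n hn
      exact Finsupp.filter_apply_neg _ _ (by simpa using hn)
    · ext1
      · exact Finsupp.filter_add_filter_not _ _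
      · simp
      · simp

end Affine

open RelaxedSl2.Affine

/-! ### Modules generated by a space of ground states -/

section Ground

local notation "ι" => UniversalEnvelopingAlgebra.ι ℂ

variable {V : Type*} [AddCommGroup V] [Module ℂ V] [Module UAffine V] [IsScalarTower ℂ UAffine V]

lemma map_smul_ι (c : ℂ) (a : Affine) (v : V) :
    (ι (c • a) : UAffine) • v = c • (ι a : UAffine) • v := by
  rw [map_smul, smul_assoc]

lemma ι_smul_mem_of_generators {S : Submodule ℂ V}
    (hx : ∀ (x : Sl2) (n : ℤ), ∀ v ∈ S, (ι (mode n x) : UAffine) • v ∈ S)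
    (hK : ∀ v ∈ S, (ι KElt : UAffine) • v ∈ S) (hL : ∀ v ∈ S, (ι LElt : UAffine) • v ∈ S)
    (a : Affine) (v : V) (hv : v ∈ S) : (ι a : UAffine) • v ∈ S := by
  rw [eq_sum_modes a, map_add, map_add, add_smul, add_smul, map_smul_ι, map_smul_ι]
  refine S.add_mem (S.add_mem ?_ (S.smul_mem _ (hK v hv))) (S.smul_mem _ (hL v hv))
  have : (ι (a.loop.sum fun n x => mode n x) : UAffine) =
      a.loop.sum fun n x => (ι (mode n x) : UAffine) :=
    map_finsuppSum (ι : Affine →ₗ⁅ℂ⁆ UAffine).toLinearMap _ _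
  rw [this, Finsupp.sum, Finset.sum_smul]
  exact S.sum_mem fun n _ => hx _ n v hv

/-- The action of `xₙ` on a module of the affine algebra. -/
abbrev modeEnd (V : Type*) [AddCommGroup V] [Module ℂ V] [Module UAffine V]
    [IsScalarTower ℂ UAffine V] (n : ℤ) (x : Sl2) : Module.End ℂ V :=
  repOfModule Affine V (mode n x)

/-- The action of `L₀` on a module of the affine algebra. -/
abbrev energy (V : Type*) [AddCommGroup V] [Module ℂ V] [Module UAffine V]
    [IsScalarTower ℂ UAffine V] : Module.End ℂ V := repOfModule Affine V LElt

lemma rep_rep (a b : Affine) (v : V) : repOfModule Affine V a (repOfModule Affine V b v) =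
    repOfModule Affine V b (repOfModule Affine V a v) + repOfModule Affine V ⁅a, b⁆ v := by
  rw [LieHom.map_lie, LieRing.of_associative_ring_bracket, LinearMap.sub_apply]
  exact (add_sub_cancel _ _).symm

lemma K_comm (a : Affine) (v : V) : repOfModule Affine V KElt (repOfModule Affine V a v) =
    repOfModule Affine V a (repOfModule Affine V KElt v) := by
  rw [rep_rep, lie_K]; simp

lemma energy_mode (n : ℤ) (x : Sl2) (v : V) : energy V (modeEnd V n x v) =
    modeEnd V n x (energy V v) - (n : ℂ) • modeEnd V n x v := by
  rw [rep_rep, lie_L_mode, map_smul, LinearMap.smul_apply, neg_smul, sub_eq_add_neg]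

lemma mode_zero_comm (n : ℤ) (x y : Sl2) (v : V) : modeEnd V 0 x (modeEnd V n y v) =
    modeEnd V n y (modeEnd V 0 x v) + modeEnd V n ⁅x, y⁆ v := by
  rw [rep_rep, lie_mode_zero]

lemma mode_mem_eigenspace {n : ℤ} {x : Sl2} {v : V} {d : ℂ} (hv : v ∈ (energy V).eigenspace d) :
    modeEnd V n x v ∈ (energy V).eigenspace (d - n) := by
  rw [Module.End.mem_eigenspace_iff] at hv ⊢
  rw [energy_mode, hv, map_smul, sub_smul]

variable (k d : ℂ)

/-- A subspace which is stable under the zero modes, annihilated by the positive modes, and on which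
`K` and `L₀` act as multiplication by `k` and `d`. -/
structure IsGround (W : Submodule ℂ V) : Prop where
  zero_mode : ∀ x, ∀ w ∈ W, modeEnd V 0 x w ∈ W
  pos_mode : ∀ x, ∀ n : ℤ, 0 < n → ∀ w ∈ W, modeEnd V n x w = 0
  K_smul : ∀ w ∈ W, repOfModule Affine V KElt w = k • w
  L_smul : ∀ w ∈ W, energy V w = d • w

/-- The vectors obtained by applying negative modes to the elements of `W`. -/
inductive IsWord (W : Submodule ℂ V) : ℤ → V → Prop
  | base (w : V) (hw : w ∈ W) : IsWord W 0 w
  | step (n j : ℤ) (x : Sl2) (v : V) (hj : 0 < j) (hv : IsWord W n v) :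
      IsWord W (n + j) (modeEnd V (-j) x v)

/-- The span of the words of degree `n`. -/
def wordSpan (W : Submodule ℂ V) (n : ℤ) : Submodule ℂ V := Submodule.span ℂ {v | IsWord W n v}

variable {k d} {W : Submodule ℂ V}

lemma IsWord.nonneg {n : ℤ} {v : V} (h : IsWord W n v) : 0 ≤ n ∧ (n = 0 → v ∈ W) := by
  induction h with
  | base w hw => exact ⟨le_rfl, fun _ => hw⟩
  | step n j x v hj hv ih => exact ⟨by omega, fun h => by omega⟩

lemma IsWord.K_smul (hW : IsGround k d W) {n : ℤ} {v : V} (h : IsWord W n v) :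
    repOfModule Affine V KElt v = k • v := by
  induction h with
  | base w hw => exact hW.K_smul w hw
  | step n j x v hj hv ih => rw [K_comm, ih, map_smul]

lemma IsWord.energy_mem (hW : IsGround k d W) {n : ℤ} {v : V} (h : IsWord W n v) :
    v ∈ (energy V).eigenspace (d + n) := by
  induction h with
  | base w hw => rw [Module.End.mem_eigenspace_iff, hW.L_smul w hw, Int.cast_zero, add_zero]
  | step n j x v hj hv ih =>
    have := mode_mem_eigenspace (n := -j) (x := x) ih
    convert this using 2
    push_cast; ring

lemma mode_neg_mem_wordSpan {n j : ℤ} (hj : 0 < j) (x : Sl2) {v : V} (hv : v ∈ wordSpan W n) :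
    modeEnd V (-j) x v ∈ wordSpan W (n + j) := by
  have : wordSpan W n ≤ (wordSpan W (n + j)).comap (modeEnd V (-j) x) :=
    Submodule.span_le.2 fun v hv => Submodule.subset_span (IsWord.step n j x v hj hv)
  exact this hv

/-- Commuting a mode past the leftmost negative mode leaves modes acting on a shorter word plus a
central scalar, so induction on the word applies. If n − m < 0 there are no words of that degree and
the result is zero. -/
lemma IsWord.mode_mem (hW : IsGround k d W) {n : ℤ} {v : V} (h : IsWord W n v) (m : ℤ) (x : Sl2) :
    modeEnd V m x v ∈ wordSpan W (n - m) := by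
  induction h generalizing m x with
  | base w hw =>
    rcases lt_trichotomy m 0 with hm | rfl | hm
    · have := mode_neg_mem_wordSpan (j := -m) (by omega) x
        (Submodule.subset_span (IsWord.base w hw))
      rwa [neg_neg, ← sub_eq_add_neg] at this
    · rw [sub_zero]
      exact Submodule.subset_span (IsWord.base _ (hW.zero_mode x w hw))
    · rw [hW.pos_mode x m hm w hw]
      exact Submodule.zero_mem _
  | step n j y v hj hv ih =>
    rw [rep_rep, lie_mode_mode, map_add, LinearMap.add_apply, map_smul,
      LinearMap.smul_apply, hv.K_smul hW]
    refine Submodule.add_mem _ ?_ (Submodule.add_mem _ ?_ ?_)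
    · have := mode_neg_mem_wordSpan hj y (ih m x)
      rwa [sub_add_eq_add_sub] at this
    · have := ih (m + -j) ⁅x, y⁆
      rwa [show n - (m + -j) = n + j - m by ring] at this
    -- The central term occurs only for m = j, and then the target degree is again n.
    · split_ifs with h
      · rw [show n + j - m = n by omega]
        exact Submodule.smul_mem _ _ (Submodule.smul_mem _ _ (Submodule.subset_span hv))
      · rw [zero_smul]; exact Submodule.zero_mem _

lemma span_le_iSup_wordSpan (hW : IsGround k d W) :
    (Submodule.span UAffine (W : Set V)).restrictScalars ℂ ≤ ⨆ n, wordSpan W n := by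
  have key : ∀ (T : Module.End ℂ V), (∀ n v, IsWord W n v → T v ∈ ⨆ n, wordSpan W n) →
      ∀ v ∈ ⨆ n, wordSpan W n, T v ∈ ⨆ n, wordSpan W n := by
    intro T hT
    have : ⨆ n, wordSpan W n ≤ (⨆ n, wordSpan W n).comap T :=
      iSup_le fun n => Submodule.span_le.2 fun v hv => hT n v hv
    exact fun v hv => this hv
  have hstab := ι_smul_mem_of_generators (S := ⨆ n, wordSpan W n)
    (fun x m => key (modeEnd V m x) fun n v hv => Submodule.mem_iSup_of_mem _ (hv.mode_mem hW m x))
    (key (repOfModule Affine V KElt) fun n v hv => by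
      rw [hv.K_smul hW]
      exact Submodule.smul_mem _ _ (Submodule.mem_iSup_of_mem n (Submodule.subset_span hv)))
    (key (energy V) fun n v hv => by
      rw [Module.End.mem_eigenspace_iff.1 (hv.energy_mem hW)]
      exact Submodule.smul_mem _ _ (Submodule.mem_iSup_of_mem n (Submodule.subset_span hv)))
  have : Submodule.span UAffine (W : Set V) ≤ submoduleOfStable _ hstab :=
    Submodule.span_le.2 fun w hw =>
      Submodule.mem_iSup_of_mem (p := wordSpan W) 0 (Submodule.subset_span (IsWord.base w hw))
  exact this

variable (V d) in
/-- The sum of the eigenspaces of `L₀` with eigenvalues `d + 1`, `d + 2`, .... -/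
def higher : Submodule ℂ V := ⨆ n : ℕ, (energy V).eigenspace (d + (n + 1 : ℕ))

/-- A word of degree 0 lies in W; one of degree n > 0 has energy d + n. -/
lemma span_le_sup_higher (hW : IsGround k d W) :
    (Submodule.span UAffine (W : Set V)).restrictScalars ℂ ≤ W ⊔ higher V d := by
  refine (span_le_iSup_wordSpan hW).trans (iSup_le fun n => Submodule.span_le.2 fun v hv => ?_)
  obtain ⟨h0, h1⟩ := hv.nonneg
  rcases h0.eq_or_lt with h | h
  · exact Submodule.mem_sup_left (h1 h.symm)
  -- Index n − 1, because `higher` starts its family at energy d + 1.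
  · refine Submodule.mem_sup_right (Submodule.mem_iSup_of_mem (n - 1).toNat ?_)
    have := hv.energy_mem hW
    convert this using 2
    have : (((n - 1).toNat + 1 : ℕ) : ℤ) = n := by omega
    rw [← this]; simp

lemma eigenspace_inf_higher : (energy V).eigenspace d ⊓ higher V d = ⊥ := by
  have h := (energy V).eigenspaces_iSupIndep d
  refine (h.mono_right ?_).eq_bot
  refine iSup_le fun n => ?_
  refine le_iSup₂_of_le (d + (n + 1 : ℕ)) ?_ le_rfl
  intro h
  have : ((n + 1 : ℕ) : ℂ) = 0 := by simpa using h
  exact Nat.succ_ne_zero n (Nat.cast_eq_zero.1 this)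

variable (k d) in
/-- The module `V` is generated by the space `W` of ground states. -/
structure IsRelaxed (W : Submodule ℂ V) : Prop extends IsGround k d W where
  span_eq_top : Submodule.span UAffine (W : Set V) = ⊤

/-! ### The grading by energy of a module generated by its ground states. -/

namespace IsRelaxed

lemma sup_higher (hW : IsRelaxed k d W) : W ⊔ higher V d = ⊤ := by
  rw [eq_top_iff]
  refine le_trans ?_ (span_le_sup_higher hW.toIsGround)
  rw [hW.span_eq_top]
  exact le_rfl

lemma le_eigenspace (hW : IsGround k d W) : W ≤ (energy V).eigenspace d := fun w hw =>
  Module.End.mem_eigenspace_iff.2 (hW.L_smul w hw)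

lemma eigenspace_eq (hW : IsRelaxed k d W) : (energy V).eigenspace d = W := by
  refine le_antisymm (fun v hv => ?_) (le_eigenspace hW.toIsGround)
  obtain ⟨w, hw, p, hp, rfl⟩ := Submodule.mem_sup.1 (hW.sup_higher ▸ Submodule.mem_top : v ∈ _)
  have hp' : p ∈ (energy V).eigenspace d ⊓ higher V d :=
    ⟨(Submodule.add_mem_iff_right _ (le_eigenspace hW.toIsGround hw)).1 hv, hp⟩
  rw [eigenspace_inf_higher, Submodule.mem_bot] at hp'
  rwa [hp', add_zero]

lemma iSup_eigenspace (hW : IsRelaxed k d W) :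
    ⨆ n : ℕ, (energy V).eigenspace (d + n) = ⊤ := by
  rw [eq_top_iff, ← hW.sup_higher]
  refine sup_le ?_ (iSup_le fun n => le_iSup (fun n : ℕ => (energy V).eigenspace (d + n)) (n + 1))
  refine (le_eigenspace hW.toIsGround).trans ?_
  refine le_trans ?_ (le_iSup (fun n : ℕ => (energy V).eigenspace (d + n)) 0)
  simp

lemma cast_injective : Function.Injective fun n : ℕ => d + n := fun m n h => by simpa using h

/-- Submodules are graded by the eigenvalues of `L₀`. -/
lemma le_iSup_inf (hW : IsRelaxed k d W) (N : Submodule UAffine V) :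
    N.restrictScalars ℂ ≤ ⨆ n : ℕ, N.restrictScalars ℂ ⊓ (energy V).eigenspace (d + n) :=
  le_iSup_inf_eigenspace cast_injective (fun _ hv => N.smul_mem _ hv)
    (hW.iSup_eigenspace ▸ le_top)

/-- Submodules are graded, so avoiding the ground states means having no component of energy d. The
right-hand condition visibly passes to sums of submodules; the left-hand one does not. -/
lemma inf_eq_bot_iff (hW : IsRelaxed k d W) (N : Submodule UAffine V) :
    N.restrictScalars ℂ ⊓ W = ⊥ ↔ N.restrictScalars ℂ ≤ higher V d := by
  constructor
  · intro h
    refine (hW.le_iSup_inf N).trans (iSup_le fun n => ?_)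
    cases n with
    | zero =>
      rw [Nat.cast_zero, add_zero, hW.eigenspace_eq, h]
      exact bot_le
    | succ n =>
      exact inf_le_right.trans
        (le_iSup (fun n : ℕ => (energy V).eigenspace (d + (n + 1 : ℕ))) n)
  · intro h
    rw [eq_bot_iff, ← eigenspace_inf_higher (d := d)]
    exact le_inf (inf_le_right.trans (le_eigenspace hW.toIsGround)) (inf_le_left.trans h)

/-- The energies d + m with m ≥ 0 already exhaust V, and distinct eigenspaces are independent. -/
lemma eigenspace_sub_eq_bot (hW : IsRelaxed k d W) (n : ℕ) :
    (energy V).eigenspace (d - (n + 1 : ℕ)) = ⊥ := by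
  have h := (energy V).eigenspaces_iSupIndep (d - (n + 1 : ℕ))
  have h' : ⨆ j, ⨆ (_ : j ≠ d - (n + 1 : ℕ)), (energy V).eigenspace j = ⊤ := by
    rw [eq_top_iff, ← hW.iSup_eigenspace]
    refine iSup_le fun m => le_iSup₂_of_le (d + m) ?_ le_rfl
    intro h
    have h2 : ((m + (n + 1) : ℕ) : ℂ) = 0 := by
      push_cast at h ⊢
      linear_combination h
    exact Nat.succ_ne_zero _ (Nat.cast_eq_zero.1 h2)
  rw [h'] at h
  exact disjoint_top.1 h

/-- The central element acts as multiplication by the level. -/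
lemma K_apply (hW : IsRelaxed k d W) (v : V) : repOfModule Affine V KElt v = k • v := by
  have hle : ⨆ n, wordSpan W n ≤ LinearMap.ker (repOfModule Affine V KElt - k • LinearMap.id) := by
    refine iSup_le fun n => Submodule.span_le.2 fun w (hw : IsWord W n w) => ?_
    simp [hw.K_smul hW.toIsGround]
  have hv : v ∈ (Submodule.span UAffine (W : Set V)).restrictScalars ℂ := by
    rw [hW.span_eq_top]; trivial
  have := hle (span_le_iSup_wordSpan hW.toIsGround hv)
  simpa [sub_eq_zero] using this

end IsRelaxed

/-- A vector of energy `d + n`, `n > 0`, annihilated by the positive modes generates a submodule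
without vectors of energy `d`. -/
lemma span_singular_le_higher {n : ℕ} {w : V} (hK : repOfModule Affine V KElt w = k • w)
    (hL : w ∈ (energy V).eigenspace (d + (n + 1 : ℕ)))
    (hpos : ∀ x, ∀ m : ℤ, 0 < m → modeEnd V m x w = 0) :
    (Submodule.span UAffine {w}).restrictScalars ℂ ≤ higher V d := by
  -- Replace w by the space of all singular vectors of its energy and level. Zero modes preserve it,
  -- so it is a ground space of energy d + n + 1 and `span_le_sup_higher` applies to it.
  let W : Submodule ℂ V :=
    LinearMap.ker (repOfModule Affine V KElt - k • LinearMap.id) ⊓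
      ((energy V).eigenspace (d + (n + 1 : ℕ)) ⊓
        ⨅ (x : Sl2) (m : {m : ℤ // 0 < m}), LinearMap.ker (modeEnd V m x))
  have hmem : ∀ v, v ∈ W ↔ repOfModule Affine V KElt v = k • v ∧
      v ∈ (energy V).eigenspace (d + (n + 1 : ℕ)) ∧
      ∀ x, ∀ m : ℤ, 0 < m → modeEnd V m x v = 0 := by
    intro v
    simp [W, sub_eq_zero]
  have hW : IsGround k (d + (n + 1 : ℕ)) W := by
    refine ⟨fun x v hv => ?_, fun x m hm v hv => ((hmem v).1 hv).2.2 x m hm,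
      fun v hv => ((hmem v).1 hv).1,
      fun v hv => Module.End.mem_eigenspace_iff.1 ((hmem v).1 hv).2.1⟩
    obtain ⟨h1, h2, h3⟩ := (hmem v).1 hv
    refine (hmem _).2 ⟨by rw [K_comm, h1, map_smul], ?_, fun y m hm => ?_⟩
    · have := mode_mem_eigenspace (n := 0) (x := x) h2
      rwa [Int.cast_zero, sub_zero] at this
    · have := mode_zero_comm m x y v
      rw [h3 y m hm, map_zero, h3 _ m hm, add_zero] at this
      exact this.symm
  have h1 : Submodule.span UAffine {w} ≤ Submodule.span UAffine (W : Set V) :=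
    Submodule.span_mono (Set.singleton_subset_iff.2 ((hmem w).2 ⟨hK, hL, hpos⟩))
  refine le_trans (b := (Submodule.span UAffine (W : Set V)).restrictScalars ℂ) h1 ?_
  refine (span_le_sup_higher hW).trans (sup_le ?_ (iSup_le fun m => ?_))
  · refine (IsRelaxed.le_eigenspace hW).trans ?_
    exact le_iSup (fun n : ℕ => (energy V).eigenspace (d + (n + 1 : ℕ))) n
  · have := le_iSup (fun n : ℕ => (energy V).eigenspace (d + (n + 1 : ℕ))) (n + 1 + m)
    refine le_trans (le_of_eq ?_) this
    congr 1
    push_cast; ring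

end Ground

/-! ### Relaxed Verma modules -/

section RelaxedVerma

variable {k Δ : ℂ} {M : Type*} [AddCommGroup M] [Module ℂ M] (r : Sl2 →ₗ⁅ℂ⁆ Module.End ℂ M)

variable (k Δ) in
/-- The embedding of `M` as the space of ground states of its relaxed Verma module. -/
abbrev ground : M →ₗ[ℂ] RelaxedVerma k Δ r := Ind.of Affine.nonneg (Affine.nonnegRep k Δ r)

lemma ground_injective : Function.Injective (ground k Δ r) :=
  Ind.of_injective isCompl_negative_nonneg _

lemma rep_ground (a : Affine) (ha : a ∈ Affine.nonneg) (m : M) :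
    repOfModule Affine (RelaxedVerma k Δ r) a (ground k Δ r m) =
      ground k Δ r (r (a.loop 0) m + (a.cK * k + a.cL * Δ) • m) :=
  Ind.ι_smul_of (r := Affine.nonnegRep k Δ r) ⟨a, ha⟩ m

lemma mode_zero_ground (x : Sl2) (m : M) :
    modeEnd (RelaxedVerma k Δ r) 0 x (ground k Δ r m) = ground k Δ r (r x m) := by
  rw [rep_ground _ _ (fun n hn => Finsupp.single_eq_of_ne hn.ne)]
  simp [mode]

lemma isRelaxed_groundStates : IsRelaxed k Δ (groundStates k Δ r) where
  zero_mode := by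
    rintro x _ ⟨m, rfl⟩
    exact ⟨_, (mode_zero_ground r x m).symm⟩
  pos_mode := by
    rintro x n hn _ ⟨m, rfl⟩
    have h : (mode n x : Affine) ∈ Affine.nonneg := fun j hj =>
      Finsupp.single_eq_of_ne (hj.trans hn).ne
    rw [rep_ground _ _ h]
    simp [mode, Finsupp.single_eq_of_ne hn.ne]
  K_smul := by
    rintro _ ⟨m, rfl⟩
    rw [rep_ground _ _ (fun n _ => rfl), ← map_smul]
    simp [KElt]
  L_smul := by
    rintro _ ⟨m, rfl⟩
    rw [rep_ground _ _ (fun n _ => rfl), ← map_smul]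
    simp [LElt]
  span_eq_top := Ind.span_range_of

/-- The sum of the submodules of a relaxed Verma module which meet the space of ground states
trivially. -/
def radical (k Δ : ℂ) (r : Sl2 →ₗ⁅ℂ⁆ Module.End ℂ M) : Submodule UAffine (RelaxedVerma k Δ r) :=
  sSup {N | N.restrictScalars ℂ ⊓ groundStates k Δ r = ⊥}

lemma sSup_le_higher {V : Type*} [AddCommGroup V] [Module ℂ V] [Module UAffine V]
    [IsScalarTower ℂ UAffine V] {d : ℂ} {S : Set (Submodule UAffine V)}
    (h : ∀ N ∈ S, N.restrictScalars ℂ ≤ higher V d) :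
    (sSup S).restrictScalars ℂ ≤ higher V d := by
  intro v (hv : v ∈ sSup S)
  rw [sSup_eq_iSup'] at hv
  induction hv using Submodule.iSup_induction' with
  | mem N v hv => exact h N N.2 hv
  | zero => exact Submodule.zero_mem _
  | add v w _ _ hv hw => exact Submodule.add_mem _ hv hw

lemma radical_le_higher :
    (radical k Δ r).restrictScalars ℂ ≤ higher (RelaxedVerma k Δ r) Δ :=
  sSup_le_higher fun N hN => ((isRelaxed_groundStates r).inf_eq_bot_iff N).1 hN

variable {r} in
lemma le_radical {N : Submodule UAffine (RelaxedVerma k Δ r)}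
    (h : N.restrictScalars ℂ ⊓ groundStates k Δ r = ⊥) : N ≤ radical k Δ r := le_sSup h

/-- The sum of the submodules avoiding the ground states still avoids them, as it stays in positive
relative energy. -/
lemma radical_inf_groundStates : (radical k Δ r).restrictScalars ℂ ⊓ groundStates k Δ r = ⊥ :=
  ((isRelaxed_groundStates r).inf_eq_bot_iff _).2 (radical_le_higher r)

variable {r} in
lemma eq_zero_of_ground_mem_radical {m : M} (h : ground k Δ r m ∈ radical k Δ r) : m = 0 := by
  have : ground k Δ r m ∈ (radical k Δ r).restrictScalars ℂ ⊓ groundStates k Δ r := ⟨h, m, rfl⟩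
  rw [radical_inf_groundStates, Submodule.mem_bot] at this
  exact ground_injective r (this.trans (map_zero _).symm)

/-- The only subspaces stable under the representation are `0` and the whole space. -/
def IsIrreducibleRep (r : Sl2 →ₗ⁅ℂ⁆ Module.End ℂ M) : Prop :=
  ∀ S : Submodule ℂ M, (∀ x, ∀ m ∈ S, r x m ∈ S) → S = ⊥ ∨ S = ⊤

variable {r} in
-- A submodule meets the ground states in a subspace stable under `𝔰𝔩₂`, hence in zero or in all of
-- them; in the second case it is everything, since the ground states generate. So being proper and
-- avoiding the ground states coincide.
lemma maxProper_eq_radical [Nontrivial M] (hr : IsIrreducibleRep r) :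
    maxProper UAffine (RelaxedVerma k Δ r) = radical k Δ r := by
  have key : ∀ N : Submodule UAffine (RelaxedVerma k Δ r),
      N ≠ ⊤ ↔ N.restrictScalars ℂ ⊓ groundStates k Δ r = ⊥ := by
    intro N
    constructor
    · intro hN
      rcases hr ((N.restrictScalars ℂ).comap (ground k Δ r)) (fun x m hm => by
        change ground k Δ r (r x m) ∈ N
        rw [← mode_zero_ground]
        exact N.smul_mem _ hm) with h | h
      · rw [eq_bot_iff]
        rintro _ ⟨hv, m, rfl⟩
        have hm : m ∈ (N.restrictScalars ℂ).comap (ground k Δ r) := hv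
        rw [h, Submodule.mem_bot] at hm
        rw [hm, map_zero]
        exact Submodule.zero_mem _
      · refine absurd ?_ hN
        rw [eq_top_iff, ← (isRelaxed_groundStates (k := k) (Δ := Δ) r).span_eq_top,
          Submodule.span_le]
        rintro _ ⟨m, rfl⟩
        exact (h ▸ Submodule.mem_top : m ∈ (N.restrictScalars ℂ).comap (ground k Δ r))
    · rintro h rfl
      obtain ⟨m, hm⟩ := exists_ne (0 : M)
      have : ground k Δ r m ∈ (⊤ : Submodule UAffine (RelaxedVerma k Δ r)).restrictScalars ℂ ⊓
        groundStates k Δ r := ⟨trivial, m, rfl⟩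
      rw [h, Submodule.mem_bot] at this
      exact hm (ground_injective r (this.trans (map_zero _).symm))
  unfold maxProper radical
  simp_rw [key]

/-! ### Functoriality -/

variable {r} {M' : Type*} [AddCommGroup M'] [Module ℂ M'] {r' : Sl2 →ₗ⁅ℂ⁆ Module.End ℂ M'}
  (φ : M →ₗ[ℂ] M')

lemma nonnegRep_intertwines {φ : M →ₗ[ℂ] M'} (hφ : ∀ x m, φ (r x m) = r' x (φ m))
    (b : Affine.nonneg) (m : M) : ground k Δ r' (φ (Affine.nonnegRep k Δ r b m)) =
    repOfModule Affine (RelaxedVerma k Δ r') b (ground k Δ r' (φ m)) := by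
  rw [rep_ground _ _ b.2, ← hφ, ← map_smul, ← map_add]
  rfl

/-- The map of relaxed Verma modules induced by a map of `sl₂`-modules. -/
def indMap (k Δ : ℂ) (hφ : ∀ x m, φ (r x m) = r' x (φ m)) :
    RelaxedVerma k Δ r →ₗ[UAffine] RelaxedVerma k Δ r' :=
  linearOfIntertwines (Ind.liftRep (repOfModule Affine (RelaxedVerma k Δ r'))
    ((ground k Δ r').comp φ) (nonnegRep_intertwines hφ))
    (Ind.liftRep_ι_smul _ _ (nonnegRep_intertwines hφ))

variable {φ} (hφ : ∀ x m, φ (r x m) = r' x (φ m))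

lemma indMap_ground (m : M) : indMap φ k Δ hφ (ground k Δ r m) = ground k Δ r' (φ m) :=
  Ind.liftRep_of _ _ (nonnegRep_intertwines hφ) m

lemma map_higher_mem {V V' : Type*} [AddCommGroup V] [Module ℂ V] [Module UAffine V]
    [IsScalarTower ℂ UAffine V] [AddCommGroup V'] [Module ℂ V'] [Module UAffine V']
    [IsScalarTower ℂ UAffine V'] {d : ℂ} (g : V →ₗ[UAffine] V') {v : V} (hv : v ∈ higher V d) :
    g v ∈ higher V' d := by
  have : higher V d ≤ (higher V' d).comap (g.restrictScalars ℂ) := by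
    refine iSup_le fun n v hv => Submodule.mem_iSup_of_mem n ?_
    rw [Module.End.mem_eigenspace_iff] at hv ⊢
    have := congrArg (g.restrictScalars ℂ) hv
    rw [map_smul] at this
    rw [← this]
    exact (g.map_smul _ _).symm
  exact this hv

/-- A module map preserves energy, so the image of the radical avoids the ground states. -/
lemma indMap_mem_radical {v : RelaxedVerma k Δ r} (hv : v ∈ radical k Δ r) :
    indMap φ k Δ hφ v ∈ radical k Δ r' := by
  have h : (radical k Δ r).map (indMap φ k Δ hφ) ≤ radical k Δ r' := by
    refine le_radical (((isRelaxed_groundStates r').inf_eq_bot_iff _).2 ?_)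
    rintro _ ⟨v, hv, rfl⟩
    exact map_higher_mem _ (radical_le_higher r hv)
  exact h ⟨v, hv, rfl⟩

/-- This yields injectivity on the quotients without injectivity of the induced map: a ground state
in the preimage of the radical maps to zero, hence is zero because φ is injective. -/
lemma mem_radical_of_indMap_mem (hinj : Function.Injective φ) {v : RelaxedVerma k Δ r}
    (hv : indMap φ k Δ hφ v ∈ radical k Δ r') : v ∈ radical k Δ r := by
  have h : (radical k Δ r').comap (indMap φ k Δ hφ) ≤ radical k Δ r := by
    refine le_radical (eq_bot_iff.2 ?_)
    rintro _ ⟨hm, m, rfl⟩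
    have hm' : indMap φ k Δ hφ (ground k Δ r m) ∈ radical k Δ r' := hm
    rw [indMap_ground] at hm'
    have := hinj ((eq_zero_of_ground_mem_radical hm').trans (map_zero φ).symm)
    rw [this, map_zero]
    exact Submodule.zero_mem _
  exact h hv

lemma indMap_surjective (hsurj : Function.Surjective φ) :
    Function.Surjective (indMap φ k Δ hφ) := by
  rw [← LinearMap.range_eq_top, eq_top_iff,
    ← (isRelaxed_groundStates (k := k) (Δ := Δ) r').span_eq_top, Submodule.span_le]
  rintro _ ⟨m', rfl⟩
  obtain ⟨m, rfl⟩ := hsurj m'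
  exact ⟨_, indMap_ground hφ m⟩

lemma isRelaxed_quotient {V : Type*} [AddCommGroup V] [Module ℂ V] [Module UAffine V]
    [IsScalarTower ℂ UAffine V] {d : ℂ} {W : Submodule ℂ V} (hW : IsRelaxed k d W)
    (J : Submodule UAffine V) :
    IsRelaxed k d (W.map (J.mkQ.restrictScalars ℂ)) where
  zero_mode := by
    rintro x _ ⟨w, hw, rfl⟩
    exact ⟨_, hW.zero_mode x w hw, rfl⟩
  pos_mode := by
    rintro x n hn _ ⟨w, hw, rfl⟩
    exact (congrArg J.mkQ (hW.pos_mode x n hn w hw)).trans (map_zero _)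
  K_smul := by
    rintro _ ⟨w, hw, rfl⟩
    exact (congrArg (J.mkQ.restrictScalars ℂ) (hW.K_smul w hw)).trans (map_smul _ _ _)
  L_smul := by
    rintro _ ⟨w, hw, rfl⟩
    exact (congrArg (J.mkQ.restrictScalars ℂ) (hW.L_smul w hw)).trans (map_smul _ _ _)
  span_eq_top := by
    have : ((W.map (J.mkQ.restrictScalars ℂ) : Submodule ℂ (V ⧸ J)) : Set (V ⧸ J)) =
      J.mkQ '' (W : Set V) := rfl
    rw [this, Submodule.span_image, hW.span_eq_top, Submodule.map_top, Submodule.range_mkQ]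

/-- In the quotient by the radical, there are no nonzero submodules of positive energy. -/
lemma eq_zero_of_span_le_higher {v : RelaxedVerma k Δ r}
    (h : (Submodule.span UAffine {(radical k Δ r).mkQ v}).restrictScalars ℂ ≤
      higher (RelaxedVerma k Δ r ⧸ radical k Δ r) Δ) : v ∈ radical k Δ r := by
  have hW := isRelaxed_quotient (isRelaxed_groundStates (k := k) (Δ := Δ) r) (radical k Δ r)
  have hN := (hW.inf_eq_bot_iff _).2 h
  have hle : (Submodule.span UAffine {(radical k Δ r).mkQ v}).comap (radical k Δ r).mkQ ≤
      radical k Δ r := by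
    refine le_radical (eq_bot_iff.2 ?_)
    rintro w ⟨hw, hw'⟩
    have : (radical k Δ r).mkQ w ∈ (⊥ : Submodule ℂ (RelaxedVerma k Δ r ⧸ radical k Δ r)) := by
      rw [← hN]
      exact ⟨hw, w, hw', rfl⟩
    rw [Submodule.mem_bot, Submodule.mkQ_apply, Submodule.Quotient.mk_eq_zero] at this
    rw [← radical_inf_groundStates r]
    exact ⟨this, hw'⟩
  exact hle (Submodule.mem_span_singleton_self _)

end RelaxedVerma

/-! ### Torsion with respect to a zero mode -/

section Torsion

local notation "ι" => UniversalEnvelopingAlgebra.ι ℂ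

variable {V : Type*} [AddCommGroup V] [Module ℂ V] [Module UAffine V] [IsScalarTower ℂ UAffine V]
  (J : Submodule UAffine V) (x : Sl2)

lemma modeEnd_zero (n : ℤ) : modeEnd V n 0 = 0 := by
  unfold modeEnd; rw [map_zero, map_zero]

lemma modeEnd_add (n : ℤ) (y z : Sl2) : modeEnd V n (y + z) = modeEnd V n y + modeEnd V n z := by
  unfold modeEnd; rw [map_add, map_add]

lemma modeEnd_smul (n : ℤ) (a : ℂ) (z : Sl2) : modeEnd V n (a • z) = a • modeEnd V n z := by
  unfold modeEnd; rw [map_smul, map_smul]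

lemma rep_mem {J : Submodule UAffine V} (a : Affine) {v : V} (hv : v ∈ J) :
    repOfModule Affine V a v ∈ J := J.smul_mem _ hv

lemma pow_rep_mem {J : Submodule UAffine V} (a : Affine) {v : V} (hv : v ∈ J) (n : ℕ) :
    (repOfModule Affine V a ^ n) v ∈ J := by
  induction n with
  | zero => exact hv
  | succ n ih => rw [pow_succ', Module.End.mul_apply]; exact rep_mem a ih

lemma pow_rep_mem_of_le {J : Submodule UAffine V} (a : Affine) {v : V} {m n : ℕ} (h : m ≤ n)
    (hv : (repOfModule Affine V a ^ m) v ∈ J) : (repOfModule Affine V a ^ n) v ∈ J := by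
  rw [← Nat.sub_add_cancel h, pow_add, Module.End.mul_apply]
  exact pow_rep_mem a hv _

/-- Leibniz rule: x₀^(n+j) z_m v is a combination of ((ad x)^i z)_m x₀^(n+j−i) v, and in each term
either i ≥ j or at least n powers of x₀ reach v. No central term arises, since x₀ has mode number 0.
-/
lemma pow_mode_mem {J : Submodule UAffine V} {x : Sl2} (m : ℤ) (j n : ℕ) (z : Sl2) (v : V)
    (hz : ((LieAlgebra.ad ℂ Sl2 x) ^ j) z = 0) (hv : (modeEnd V 0 x ^ n) v ∈ J) :
    (modeEnd V 0 x ^ (n + j)) (modeEnd V m z v) ∈ J := by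
  induction j generalizing n z v with
  | zero =>
    have : z = 0 := hz
    rw [this, modeEnd_zero, LinearMap.zero_apply, map_zero]
    exact J.zero_mem
  | succ j ihj =>
    induction n generalizing v with
    | zero => exact pow_rep_mem _ (rep_mem _ hv) _
    | succ n ihn =>
      rw [← add_assoc, pow_succ, Module.End.mul_apply, mode_zero_comm, map_add]
      refine J.add_mem ?_ ?_
      · have := ihn (modeEnd V 0 x v) (by rwa [pow_succ] at hv)
        rwa [← add_assoc, add_right_comm] at this
      · exact ihj (n + 1) ⁅x, z⁆ v (by rwa [pow_succ] at hz) hv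

/-- The Leibniz rule in the other direction: powers of x₀ are carried from the inside to the outside
of z_m. Each exchange replaces z by [x, z], so the exponent n has to serve all z at once. -/
lemma mode_pow_mem {J : Submodule UAffine V} {x : Sl2} (m : ℤ) (n : ℕ) (v : V)
    (hv : ∀ z, (modeEnd V 0 x ^ n) (modeEnd V m z v) ∈ J) (j : ℕ) (z : Sl2)
    (hz : ((LieAlgebra.ad ℂ Sl2 x) ^ j) z = 0) (s t : ℕ) (hst : n + j ≤ s + t) :
    (modeEnd V 0 x ^ s) (modeEnd V m z ((modeEnd V 0 x ^ t) v)) ∈ J := by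
  induction j generalizing z s t with
  | zero =>
    have : z = 0 := hz
    rw [this, modeEnd_zero, LinearMap.zero_apply, map_zero]
    exact J.zero_mem
  | succ j ihj =>
    induction t generalizing s with
    | zero => exact pow_rep_mem_of_le _ (by omega) (hv z)
    | succ t iht =>
      -- One factor is already outside; exchanging it back costs the term with [x, z], for which j
      -- has dropped.
      have h1 := iht (s + 1) (by omega)
      have h2 := ihj ⁅x, z⁆ (by rwa [pow_succ] at hz) s t (by omega)
      rw [pow_succ, Module.End.mul_apply, mode_zero_comm, map_add] at h1
      rw [pow_succ', Module.End.mul_apply]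
      exact (J.add_mem_iff_left h2).1 h1

/-- The vectors which are mapped to `J` by a power of the zero mode of an ad-nilpotent element. -/
def torsion (hx : ∀ z, ((LieAlgebra.ad ℂ Sl2 x) ^ 3) z = 0) : Submodule UAffine V :=
  submoduleOfStable
    (S :=
      { carrier := {v | ∃ n : ℕ, (modeEnd V 0 x ^ n) v ∈ J}
        add_mem' := by
          rintro v w ⟨m, hm⟩ ⟨n, hn⟩
          refine ⟨m + n, ?_⟩
          rw [map_add]
          exact J.add_mem (pow_rep_mem_of_le _ (Nat.le_add_right _ _) hm)
            (pow_rep_mem_of_le _ (Nat.le_add_left _ _) hn)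
        zero_mem' := ⟨0, J.zero_mem⟩
        smul_mem' := by
          rintro a v ⟨n, hn⟩
          refine ⟨n, ?_⟩
          rw [map_smul]
          exact (J.restrictScalars ℂ).smul_mem a hn })
    (ι_smul_mem_of_generators
      (fun z m v ⟨n, hn⟩ => ⟨n + 3, pow_mode_mem m 3 n z v (hx z) hn⟩)
      (fun v ⟨n, hn⟩ => ⟨n, by
        have h : Commute (repOfModule Affine V KElt) (modeEnd V 0 x) :=
          LinearMap.ext fun v => K_comm _ v
        have := DFunLike.congr_fun (h.pow_right n).eq v
        exact this ▸ rep_mem KElt hn⟩)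
      (fun v ⟨n, hn⟩ => ⟨n, by
        have h : Commute (energy V) (modeEnd V 0 x) :=
          LinearMap.ext fun v => by simp [energy_mode]
        have := DFunLike.congr_fun (h.pow_right n).eq v
        exact this ▸ rep_mem LElt hn⟩))

/-- For each exponent the admissible z form a subspace; these subspaces increase inside the
finite-dimensional `𝔰𝔩₂` and so stabilise. -/
lemma exists_uniform_pow {J : Submodule UAffine V} {x : Sl2} {v : V} {m : ℤ}
    (h : ∀ z, ∃ n : ℕ, (modeEnd V 0 x ^ n) (modeEnd V m z v) ∈ J) :
    ∃ n : ℕ, ∀ z, (modeEnd V 0 x ^ n) (modeEnd V m z v) ∈ J := by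
  let S : ℕ →o Submodule ℂ Sl2 :=
    { toFun := fun n =>
        { carrier := {z | (modeEnd V 0 x ^ n) (modeEnd V m z v) ∈ J}
          add_mem' := fun {z z'} (hz : _ ∈ J) (hz' : _ ∈ J) => by
            change (modeEnd V 0 x ^ n) (modeEnd V m (z + z') v) ∈ J
            rw [modeEnd_add, LinearMap.add_apply, map_add]
            exact J.add_mem hz hz'
          zero_mem' := by
            change (modeEnd V 0 x ^ n) (modeEnd V m 0 v) ∈ J
            rw [modeEnd_zero, LinearMap.zero_apply, map_zero]
            exact J.zero_mem
          smul_mem' := fun a z (hz : _ ∈ J) => by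
            change (modeEnd V 0 x ^ n) (modeEnd V m (a • z) v) ∈ J
            rw [modeEnd_smul, LinearMap.smul_apply, map_smul]
            exact (J.restrictScalars ℂ).smul_mem a hz }
      monotone' := fun a b hab z hz => pow_rep_mem_of_le _ hab hz }
  obtain ⟨n, hn⟩ := monotone_stabilizes_iff_noetherian.2 (inferInstance : IsNoetherian ℂ Sl2) S
  refine ⟨n, fun z => ?_⟩
  obtain ⟨j, hj⟩ := h z
  have hz : z ∈ S (max n j) := pow_rep_mem_of_le _ (le_max_right n j) hj
  rw [← hn _ (le_max_left n j)] at hz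
  exact hz

end Torsion

/-! ### Representations of `sl₂` with nonintegral weights -/

section Sl2Operators

variable {V : Type*} [AddCommGroup V] [Module ℂ V] {E F H : Module.End ℂ V}

lemma map_pow_apply {V' : Type*} [AddCommGroup V'] [Module ℂ V'] {A : Module.End ℂ V}
    {A' : Module.End ℂ V'} {g : V →ₗ[ℂ] V'} (h : ∀ v, g (A v) = A' (g v)) (n : ℕ) (v : V) :
    g ((A ^ n) v) = (A' ^ n) (g v) := by
  induction n generalizing v with
  | zero => rfl
  | succ n ih => rw [pow_succ, pow_succ, Module.End.mul_apply, Module.End.mul_apply, ih, h]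

lemma weight_pow {b : ℂ} (hHF : ∀ v, H (F v) = F (H v) + b • F v) {c : ℂ} {w : V}
    (hw : H w = c • w) (n : ℕ) : H ((F ^ n) w) = (c + b * n) • (F ^ n) w := by
  induction n with
  | zero => simpa using hw
  | succ n ih =>
    rw [pow_succ', Module.End.mul_apply, hHF, ih, map_smul]
    push_cast
    module

/-- The coefficient is the sum of the weights c, c − 2, …, c − 2n met while E passes the powers of
F. -/
lemma raise_lower_pow (hEF : ∀ v, E (F v) = F (E v) + H v)
    (hHF : ∀ v, H (F v) = F (H v) + (-2 : ℂ) • F v) {c : ℂ} {w : V}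
    (hw : H w = c • w) (hE : E w = 0) (n : ℕ) :
    E ((F ^ (n + 1)) w) = ((n + 1) * (c - n) : ℂ) • (F ^ n) w := by
  induction n with
  | zero => simp [hEF, hE, hw]
  | succ n ih =>
    rw [pow_succ' F (n + 1), Module.End.mul_apply, hEF, ih, weight_pow hHF hw, map_smul,
      ← Module.End.mul_apply, ← pow_succ']
    push_cast
    module

lemma exists_pow_ne_zero_pow_succ_eq_zero {A : Module.End ℂ V} {v : V} (hv : v ≠ 0)
    (h : ∃ n : ℕ, (A ^ n) v = 0) : ∃ n : ℕ, (A ^ n) v ≠ 0 ∧ (A ^ (n + 1)) v = 0 := by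
  classical
  have h1 := Nat.find_spec h
  have h0 : Nat.find h ≠ 0 := fun h0 => hv (by rw [h0] at h1; exact h1)
  obtain ⟨n, hn⟩ := Nat.exists_eq_succ_of_ne_zero h0
  exact ⟨n, Nat.find_min h (by omega), by rw [hn] at h1; exact h1⟩

/-- If `e` and `f` act locally nilpotently, then the weights are integral. -/
lemma eq_zero_of_locally_nilpotent (hEF : ∀ v, E (F v) = F (E v) + H v)
    (hHF : ∀ v, H (F v) = F (H v) + (-2 : ℂ) • F v) (hHE : ∀ v, H (E v) = E (H v) + (2 : ℂ) • E v)
    {c : ℂ} (hc : ∀ n : ℤ, c ≠ n) {v : V} (hv : H v = c • v) (hE : ∃ n : ℕ, (E ^ n) v = 0)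
    (hF : ∀ j : ℕ, ∃ n : ℕ, (F ^ n) ((E ^ j) v) = 0) : v = 0 := by
  by_contra hne
  obtain ⟨j, hj, hj'⟩ := exists_pow_ne_zero_pow_succ_eq_zero hne hE
  obtain ⟨n, hn, hn'⟩ := exists_pow_ne_zero_pow_succ_eq_zero hj (hF j)
  have hE' : E ((E ^ j) v) = 0 := by rwa [← Module.End.mul_apply, ← pow_succ']
  -- The vector E^j v is a highest weight vector of weight c + 2j, and F^(n+1) is the first power to
  -- kill it. Hence (n+1)(c + 2j − n) = 0 and c would be an integer.
  have h := raise_lower_pow hEF hHF (weight_pow hHE hv j) hE' n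
  rw [hn', map_zero] at h
  rcases smul_eq_zero.1 h.symm with h | h
  · rcases mul_eq_zero.1 h with h | h
    · exact Nat.cast_add_one_ne_zero n h
    · refine hc (n - 2 * j) ?_
      push_cast
      linear_combination h
  · exact hn h

end Sl2Operators

/-! ### Exactness -/

section Exactness

variable {k Δ : ℂ} {M M' M'' : Type*} [AddCommGroup M] [Module ℂ M] [AddCommGroup M'] [Module ℂ M']
  [AddCommGroup M''] [Module ℂ M''] {r : Sl2 →ₗ⁅ℂ⁆ Module.End ℂ M}
  {r' : Sl2 →ₗ⁅ℂ⁆ Module.End ℂ M'} {r'' : Sl2 →ₗ⁅ℂ⁆ Module.End ℂ M''}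
  {φ : M' →ₗ[ℂ] M} {ψ : M →ₗ[ℂ] M''}

lemma pow_mode_zero_ground (x : Sl2) (n : ℕ) (m : M) :
    (modeEnd (RelaxedVerma k Δ r) 0 x ^ n) (ground k Δ r m) = ground k Δ r ((r x ^ n) m) :=
  (map_pow_apply (fun m => (mode_zero_ground r x m).symm) n m).symm

/-- Induction on energy; only the modules at the ground level are known, and the radical transports
nilpotency of e₀ upwards through singular vectors. -/
lemma comap_radical_le_torsion (hφ : ∀ x m, φ (r' x m) = r x (φ m))
    (hψ : ∀ x m, ψ (r x m) = r'' x (ψ m)) (hexact : ∀ m, ψ m = 0 → m ∈ LinearMap.range φ)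
    (he : ∀ m, ∃ n : ℕ, (r' eElt ^ n) m = 0) :
    (radical k Δ r'').comap (indMap ψ k Δ hψ) ≤ torsion (radical k Δ r) eElt ad_e_pow_three := by
  set Y := (radical k Δ r'').comap (indMap ψ k Δ hψ)
  have hV := isRelaxed_groundStates (k := k) (Δ := Δ) r
  have key : ∀ n : ℕ, ∀ w ∈ Y, w ∈ (energy (RelaxedVerma k Δ r)).eigenspace (Δ + n) →
      w ∈ torsion (radical k Δ r) eElt ad_e_pow_three := by
    intro n
    induction n using Nat.strong_induction_on with
    | _ n ih =>
      intro w hw hwn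
      cases n with
      -- At ground level the radical is invisible: the vector lies in the kernel of ψ, hence in the
      -- image of φ, where e is nilpotent.
      | zero =>
        rw [Nat.cast_zero, add_zero, hV.eigenspace_eq] at hwn
        obtain ⟨m, rfl⟩ := hwn
        have h1 : indMap ψ k Δ hψ (ground k Δ r m) ∈ radical k Δ r'' := hw
        rw [indMap_ground] at h1
        obtain ⟨m', rfl⟩ := hexact m (eq_zero_of_ground_mem_radical h1)
        obtain ⟨n, hn⟩ := he m'
        refine ⟨n, ?_⟩
        have h2 : (modeEnd (RelaxedVerma k Δ r) 0 eElt ^ n) (ground k Δ r (φ m')) = 0 := by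
          rw [pow_mode_zero_ground, ← map_pow_apply (hφ eElt), hn, map_zero, map_zero]
        exact h2 ▸ Submodule.zero_mem _
      | succ n =>
        have hmode : ∀ (j : ℕ) (z : Sl2),
            modeEnd (RelaxedVerma k Δ r) (j + 1 : ℕ) z w ∈
              torsion (radical k Δ r) eElt ad_e_pow_three := by
          intro j z
          have h1 := mode_mem_eigenspace (n := ((j + 1 : ℕ) : ℤ)) (x := z) hwn
          -- The mode j + 1 lowers the relative energy n + 1 to n − j; for j > n this is negative
          -- and the vector vanishes.
          by_cases hj : j ≤ n
          · refine ih (n - j) (by omega) _ (rep_mem _ hw) ?_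
            convert h1 using 2
            push_cast [Nat.cast_sub hj]
            ring
          · have h2 : Δ + ((n + 1 : ℕ) : ℂ) - (((j + 1 : ℕ) : ℤ) : ℂ) =
                Δ - ((j - n - 1 + 1 : ℕ) : ℂ) := by
              rw [show j - n - 1 + 1 = j - n by omega, Nat.cast_sub (by omega)]
              push_cast; ring
            rw [h2, hV.eigenspace_sub_eq_bot, Submodule.mem_bot] at h1
            rw [h1]
            exact Submodule.zero_mem _
        choose K hK using fun j => exists_uniform_pow (hmode j)
        have hvan : ∀ j : ℕ, n < j → ∀ z, modeEnd (RelaxedVerma k Δ r) (j + 1 : ℕ) z w = 0 := by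
          intro j hj z
          have h1 := mode_mem_eigenspace (n := ((j + 1 : ℕ) : ℤ)) (x := z) hwn
          have h2 : Δ + ((n + 1 : ℕ) : ℂ) - (((j + 1 : ℕ) : ℤ) : ℂ) =
              Δ - ((j - n - 1 + 1 : ℕ) : ℂ) := by
            rw [show j - n - 1 + 1 = j - n by omega, Nat.cast_sub (by omega)]
            push_cast; ring
          rwa [h2, hV.eigenspace_sub_eq_bot, Submodule.mem_bot] at h1
        -- Only the modes 1, …, n + 1 can act nontrivially on w, so one exponent serves them all.
        let S := (Finset.range (n + 1)).sup K
        have hS : ∀ (j : ℕ) (z : Sl2), (modeEnd (RelaxedVerma k Δ r) 0 eElt ^ S)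
            (modeEnd (RelaxedVerma k Δ r) (j + 1 : ℕ) z w) ∈ radical k Δ r := by
          intro j z
          by_cases hj : j ≤ n
          · exact pow_rep_mem_of_le _ (Finset.le_sup (Finset.mem_range.2 (by omega))) (hK j z)
          · rw [hvan j (by omega), map_zero]
            exact Submodule.zero_mem _
        -- The extra 3 pays for moving z_m past the powers of e₀. The class of e₀^(S+3) w is then
        -- singular of positive relative energy, so it generates nothing at ground level and must
        -- vanish modulo the radical.
        refine ⟨S + 3, eq_zero_of_span_le_higher ?_⟩
        set u := (modeEnd (RelaxedVerma k Δ r) 0 eElt ^ (S + 3)) w with hu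
        have hun : u ∈ (energy (RelaxedVerma k Δ r)).eigenspace (Δ + (n + 1 : ℕ)) := by
          rw [Module.End.mem_eigenspace_iff] at hwn ⊢
          have := weight_pow (H := energy (RelaxedVerma k Δ r)) (b := 0)
            (F := modeEnd (RelaxedVerma k Δ r) 0 eElt) (fun v => by simp [energy_mode]) hwn (S + 3)
          rwa [zero_mul, add_zero] at this
        refine span_singular_le_higher (k := k) (n := n) ?_ ?_ ?_
        · exact (isRelaxed_quotient hV _).K_apply _
        · rw [Module.End.mem_eigenspace_iff] at hun ⊢
          exact (congrArg ((radical k Δ r).mkQ.restrictScalars ℂ) hun).trans (map_smul _ _ _)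
        · intro z m hm
          obtain ⟨j, rfl⟩ : ∃ j : ℕ, m = (j + 1 : ℕ) := ⟨(m - 1).toNat, by omega⟩
          refine (Submodule.Quotient.mk_eq_zero _).2
            (mode_pow_mem (J := radical k Δ r) (x := eElt) (j + 1 : ℕ) S w (hS j) 3 z
              (ad_e_pow_three z) 0 (S + 3) (by omega))
  have hle : Y.restrictScalars ℂ ≤
      (torsion (radical k Δ r) eElt ad_e_pow_three).restrictScalars ℂ :=
    (hV.le_iSup_inf Y).trans (iSup_le fun n w hw => key n w hw.1 hw.2)
  exact hle

/-- Torsion is a submodule, so ground states suffice: a power of f sends ψ m to zero, and so m into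
the image of φ. -/
lemma torsion_range_eq_top (hφ : ∀ x m, φ (r' x m) = r x (φ m))
    (hψ : ∀ x m, ψ (r x m) = r'' x (ψ m)) (hexact : ∀ m, ψ m = 0 → m ∈ LinearMap.range φ)
    (hf : ∀ m, ∃ n : ℕ, (r'' fElt ^ n) m = 0) :
    torsion (LinearMap.range (indMap φ k Δ hφ)) fElt ad_f_pow_three = ⊤ := by
  rw [eq_top_iff, ← (isRelaxed_groundStates (k := k) (Δ := Δ) r).span_eq_top, Submodule.span_le]
  rintro _ ⟨m, rfl⟩
  obtain ⟨n, hn⟩ := hf (ψ m)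
  rw [← map_pow_apply (hψ fElt)] at hn
  obtain ⟨m', hm'⟩ := hexact _ hn
  refine ⟨n, ?_⟩
  have : (modeEnd (RelaxedVerma k Δ r) 0 fElt ^ n) (ground k Δ r m) =
      indMap φ k Δ hφ (ground k Δ r' m') := by
    rw [pow_mode_zero_ground, indMap_ground, hm']
  exact this ▸ ⟨_, rfl⟩

lemma mode_weight_mem {V : Type*} [AddCommGroup V] [Module ℂ V] [Module UAffine V]
    [IsScalarTower ℂ UAffine V] {x : Sl2} {b c : ℂ} (hx : ⁅hElt, x⁆ = b • x) (n : ℤ) {v : V}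
    (hv : v ∈ (modeEnd V 0 hElt).eigenspace c) :
    modeEnd V n x v ∈ (modeEnd V 0 hElt).eigenspace (c + b) := by
  rw [Module.End.mem_eigenspace_iff] at hv ⊢
  rw [mode_zero_comm, hv, hx, modeEnd_smul, map_smul, add_smul, LinearMap.smul_apply]

/-- The sum of these weight spaces contains the ground states and is stable, because every mode
shifts weights by −2, 0 or 2 while K and L₀ shift them by 0. -/
lemma iSup_weight_eq_top {c : ℂ} (hh : ⨆ j : ℤ, (r hElt).eigenspace (c + 2 * j) = ⊤) :
    ⨆ j : ℤ, (modeEnd (RelaxedVerma k Δ r) 0 hElt).eigenspace (c + 2 * j) = ⊤ := by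
  set S := ⨆ j : ℤ, (modeEnd (RelaxedVerma k Δ r) 0 hElt).eigenspace (c + 2 * j) with hS
  have key : ∀ (T : Module.End ℂ (RelaxedVerma k Δ r)) (i : ℤ),
      (∀ (j : ℤ), ∀ v ∈ (modeEnd (RelaxedVerma k Δ r) 0 hElt).eigenspace (c + 2 * j),
        T v ∈ (modeEnd (RelaxedVerma k Δ r) 0 hElt).eigenspace (c + 2 * j + 2 * i)) →
      ∀ v ∈ S, T v ∈ S := by
    intro T i hT
    have : S ≤ S.comap T := iSup_le fun j v hv => Submodule.mem_iSup_of_mem (j + i) (by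
      have := hT j v hv
      convert this using 2
      push_cast; ring)
    exact fun v hv => this hv
  have hcomm : ∀ a : Affine, ⁅a, mode 0 hElt⁆ = 0 →
      ∀ v ∈ S, repOfModule Affine (RelaxedVerma k Δ r) a v ∈ S := by
    intro a ha
    refine key _ 0 fun j v hv => ?_
    rw [Module.End.mem_eigenspace_iff] at hv ⊢
    have := rep_rep a (mode 0 hElt) v
    rw [ha, map_zero, LinearMap.zero_apply, add_zero] at this
    rw [← this, hv, map_smul]
    simp
  have hstab := ι_smul_mem_of_generators (S := S) (fun x n v hv => by
      have h1 : modeEnd (RelaxedVerma k Δ r) n hElt v ∈ S :=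
        key _ 0 (fun j v hv => by
          simpa using mode_weight_mem (x := hElt) (b := 0) (by simp) n hv) v hv
      have h2 : modeEnd (RelaxedVerma k Δ r) n eElt v ∈ S :=
        key _ 1 (fun j v hv => by
          simpa using mode_weight_mem (x := eElt) (b := 2) lie_h_e n hv) v hv
      have h3 : modeEnd (RelaxedVerma k Δ r) n fElt v ∈ S :=
        key _ (-1) (fun j v hv => by
          simpa using mode_weight_mem (x := fElt) (b := -2) (by rw [lie_h_f, neg_smul]) n hv) v hv
      change modeEnd (RelaxedVerma k Δ r) n x v ∈ S
      rw [sl2_eq x, modeEnd_add, modeEnd_add, modeEnd_smul, modeEnd_smul, modeEnd_smul]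
      exact S.add_mem (S.add_mem (S.smul_mem _ h1) (S.smul_mem _ h2)) (S.smul_mem _ h3))
    (hcomm KElt (lie_K _)) (hcomm LElt (by rw [lie_L_mode]; simp))
  have hground : groundStates k Δ r ≤ S := by
    rw [groundStates, LinearMap.range_eq_map, ← hh, Submodule.map_iSup]
    refine iSup_mono fun j => ?_
    rintro _ ⟨m, hm, rfl⟩
    have hm' := Module.End.mem_eigenspace_iff.1 hm
    rw [Module.End.mem_eigenspace_iff]
    exact (mode_zero_ground r hElt m).trans (by rw [hm', map_smul])
  have : (⊤ : Submodule UAffine (RelaxedVerma k Δ r)) ≤ submoduleOfStable S hstab := by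
    rw [← (isRelaxed_groundStates (k := k) (Δ := Δ) r).span_eq_top]
    exact Submodule.span_le.2 hground
  exact eq_top_iff.2 fun v _ => this (Submodule.mem_top : v ∈ ⊤)

/-- Exactness in the middle: an element of the kernel comes from the submodule. -/
lemma mem_sup_of_indMap_mem_radical (hφ : ∀ x m, φ (r' x m) = r x (φ m))
    (hψ : ∀ x m, ψ (r x m) = r'' x (ψ m)) (hexact : ∀ m, ψ m = 0 → m ∈ LinearMap.range φ)
    (he : ∀ m, ∃ n : ℕ, (r' eElt ^ n) m = 0) (hf : ∀ m, ∃ n : ℕ, (r'' fElt ^ n) m = 0)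
    {c : ℂ} (hc : ∀ n : ℤ, c ≠ n) (hh : ⨆ j : ℤ, (r hElt).eigenspace (c + 2 * j) = ⊤)
    {v : RelaxedVerma k Δ r} (hv : indMap ψ k Δ hψ v ∈ radical k Δ r'') :
    v ∈ LinearMap.range (indMap φ k Δ hφ) ⊔ radical k Δ r := by
  set J := LinearMap.range (indMap φ k Δ hφ) ⊔ radical k Δ r with hJ
  set Q := RelaxedVerma k Δ r ⧸ J
  -- The defect of exactness: the kernel modulo what comes from the image and the radical. The goal
  -- is N = 0.
  let N : Submodule UAffine Q := ((radical k Δ r'').comap (indMap ψ k Δ hψ)).map J.mkQ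
  have hpow : ∀ (x : Sl2) (n : ℕ) (u : RelaxedVerma k Δ r),
      (modeEnd Q 0 x ^ n) (J.mkQ u) = J.mkQ ((modeEnd (RelaxedVerma k Δ r) 0 x ^ n) u) :=
    fun x n u => (map_pow_apply (g := J.mkQ.restrictScalars ℂ) (A' := modeEnd Q 0 x)
      (A := modeEnd (RelaxedVerma k Δ r) 0 x) (fun _ => rfl) n u).symm
  have hE : ∀ u ∈ N, ∃ n : ℕ, (modeEnd Q 0 eElt ^ n) u = 0 := by
    rintro _ ⟨u, hu, rfl⟩
    obtain ⟨n, hn⟩ := comap_radical_le_torsion hφ hψ hexact he hu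
    refine ⟨n, ?_⟩
    rw [hpow]
    exact (Submodule.Quotient.mk_eq_zero _).2 (Submodule.mem_sup_right hn)
  have hF : ∀ u : Q, ∃ n : ℕ, (modeEnd Q 0 fElt ^ n) u = 0 := by
    intro u
    obtain ⟨u, rfl⟩ := J.mkQ_surjective u
    have hu : u ∈ torsion (LinearMap.range (indMap φ k Δ hφ)) fElt ad_f_pow_three :=
      torsion_range_eq_top hφ hψ hexact hf ▸ Submodule.mem_top
    obtain ⟨n, hn⟩ := hu
    refine ⟨n, ?_⟩
    rw [hpow]
    exact (Submodule.Quotient.mk_eq_zero _).2 (Submodule.mem_sup_left hn)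
  have hH : ⨆ j : ℤ, (modeEnd Q 0 hElt).eigenspace (c + 2 * j) = ⊤ := by
    rw [eq_top_iff]
    intro u _
    obtain ⟨u, rfl⟩ := J.mkQ_surjective u
    have hle : ⨆ j : ℤ, (modeEnd (RelaxedVerma k Δ r) 0 hElt).eigenspace (c + 2 * j) ≤
        (⨆ j : ℤ, (modeEnd Q 0 hElt).eigenspace (c + 2 * j)).comap (J.mkQ.restrictScalars ℂ) := by
      refine iSup_le fun j w hw => Submodule.mem_iSup_of_mem j ?_
      rw [Module.End.mem_eigenspace_iff] at hw ⊢
      exact (congrArg (J.mkQ.restrictScalars ℂ) hw).trans (map_smul _ _ _)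
    rw [iSup_weight_eq_top hh] at hle
    exact hle trivial
  -- Every weight vector of N has weight c + 2j, never an integer, and is killed by powers of both
  -- e₀ and f₀, so it is zero.
  have hN : N.restrictScalars ℂ ≤ ⊥ := by
    refine (le_iSup_inf_eigenspace (T := modeEnd Q 0 hElt) (c := fun j : ℤ => c + 2 * j)
      (fun i j h => by simpa using h) (fun u hu => N.smul_mem _ hu) (hH ▸ le_top)).trans
      (iSup_le fun j u hu => ?_)
    obtain ⟨huN, hu⟩ := hu
    replace hu := Module.End.mem_eigenspace_iff.1 hu
    refine eq_zero_of_locally_nilpotent (E := modeEnd Q 0 eElt) (F := modeEnd Q 0 fElt)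
      (H := modeEnd Q 0 hElt) (fun v => ?_) (fun v => ?_) (fun v => ?_) (c := c + 2 * j) ?_ hu
      (hE u huN) (fun _ => hF _)
    · rw [mode_zero_comm, lie_e_f]
    · rw [mode_zero_comm, lie_h_f, ← neg_smul, modeEnd_smul, LinearMap.smul_apply]
    · rw [mode_zero_comm, lie_h_e, modeEnd_smul, LinearMap.smul_apply]
    · intro n hn
      refine hc (n - 2 * j) ?_
      push_cast
      linear_combination hn
  have h0 : J.mkQ v ∈ (⊥ : Submodule ℂ Q) := hN ⟨v, hv, rfl⟩
  exact (Submodule.Quotient.mk_eq_zero J).1 h0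

/-- A short exact sequence `0 → M' → M → M'' → 0` of `sl₂`-modules, in which `M'` and `M''` are
irreducible, induces a short exact sequence of quotients of relaxed Verma modules. -/
theorem exists_exact_sequence [Nontrivial M'] [Nontrivial M''] (hr' : IsIrreducibleRep r')
    (hr'' : IsIrreducibleRep r'') (hinj : Function.Injective φ) (hsurj : Function.Surjective ψ)
    (hexact : ∀ m, ψ m = 0 ↔ m ∈ LinearMap.range φ)
    (hφ : ∀ x m, φ (r' x m) = r x (φ m)) (hψ : ∀ x m, ψ (r x m) = r'' x (ψ m))
    (he : ∀ m, ∃ n : ℕ, (r' eElt ^ n) m = 0) (hf : ∀ m, ∃ n : ℕ, (r'' fElt ^ n) m = 0)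
    {c : ℂ} (hc : ∀ n : ℤ, c ≠ n) (hh : ⨆ j : ℤ, (r hElt).eigenspace (c + 2 * j) = ⊤) (k Δ : ℂ) :
    ∃ (i : (RelaxedVerma k Δ r' ⧸ maxProper UAffine (RelaxedVerma k Δ r')) →ₗ[UAffine]
        (RelaxedVerma k Δ r ⧸ radical k Δ r))
      (p : (RelaxedVerma k Δ r ⧸ radical k Δ r) →ₗ[UAffine]
        (RelaxedVerma k Δ r'' ⧸ maxProper UAffine (RelaxedVerma k Δ r''))),
      Function.Injective i ∧ Function.Exact i p ∧ Function.Surjective p := by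
  rw [maxProper_eq_radical hr', maxProper_eq_radical hr'']
  refine ⟨Submodule.mapQ _ _ (indMap φ k Δ hφ) fun v hv => indMap_mem_radical hφ hv,
    Submodule.mapQ _ _ (indMap ψ k Δ hψ) fun v hv => indMap_mem_radical hψ hv, ?_, ?_, ?_⟩
  · rw [injective_iff_map_eq_zero]
    intro v hv
    obtain ⟨v, rfl⟩ := Submodule.mkQ_surjective _ v
    exact (Submodule.Quotient.mk_eq_zero _).2
      (mem_radical_of_indMap_mem hφ hinj ((Submodule.Quotient.mk_eq_zero _).1 hv))
  · intro v
    obtain ⟨v, rfl⟩ := Submodule.mkQ_surjective _ v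
    constructor
    · intro hv
      obtain ⟨_, ⟨u, rfl⟩, w, hw, rfl⟩ := Submodule.mem_sup.1
        (mem_sup_of_indMap_mem_radical hφ hψ (fun m => (hexact m).1) he hf hc hh
          ((Submodule.Quotient.mk_eq_zero _).1 hv))
      refine ⟨Submodule.mkQ _ u, ?_⟩
      rw [map_add]
      exact left_eq_add.2 ((Submodule.Quotient.mk_eq_zero _).2 hw)
    · rintro ⟨u, hu⟩
      obtain ⟨u, rfl⟩ := Submodule.mkQ_surjective _ u
      rw [← hu]
      refine (Submodule.Quotient.mk_eq_zero _).2 ?_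
      -- The composite vanishes on ground states, which generate.
      have hcomp : LinearMap.range (indMap φ k Δ hφ) ≤ LinearMap.ker (indMap ψ k Δ hψ) := by
        rw [LinearMap.range_eq_map, ← (isRelaxed_groundStates (k := k) (Δ := Δ) r').span_eq_top,
          Submodule.map_span, Submodule.span_le]
        rintro _ ⟨_, ⟨m, rfl⟩, rfl⟩
        rw [SetLike.mem_coe, LinearMap.mem_ker, indMap_ground, indMap_ground,
          (hexact _).2 ⟨m, rfl⟩, map_zero]
      rw [LinearMap.mem_ker.1 (hcomp ⟨u, rfl⟩)]
      exact Submodule.zero_mem _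
  · intro v
    obtain ⟨v, rfl⟩ := Submodule.mkQ_surjective _ v
    obtain ⟨u, rfl⟩ := indMap_surjective hψ hsurj v
    exact ⟨Submodule.mkQ _ u, rfl⟩

end Exactness

/-! ### Irreducibility of Verma modules -/

section HighestWeight

variable {V : Type*} [AddCommGroup V] [Module ℂ V] {E F H : Module.End ℂ V}
  {c : ℂ} {w : V}

/-- The operators are abstract so that lowest weight modules are covered as well, through the triple
(f, e, −h). -/
lemma span_pow_stable (hEF : ∀ v, E (F v) = F (E v) + H v)
    (hHF : ∀ v, H (F v) = F (H v) + (-2 : ℂ) • F v) (hw : H w = c • w) (hE : E w = 0) {v : V}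
    (hv : v ∈ Submodule.span ℂ (Set.range fun n : ℕ => (F ^ n) w)) :
    E v ∈ Submodule.span ℂ (Set.range fun n : ℕ => (F ^ n) w) ∧
    F v ∈ Submodule.span ℂ (Set.range fun n : ℕ => (F ^ n) w) ∧
    H v ∈ Submodule.span ℂ (Set.range fun n : ℕ => (F ^ n) w) := by
  set S := Submodule.span ℂ (Set.range fun n : ℕ => (F ^ n) w)
  have hu : ∀ n : ℕ, (F ^ n) w ∈ S := fun n => Submodule.subset_span ⟨n, rfl⟩
  have key : ∀ T : Module.End ℂ V, (∀ n : ℕ, T ((F ^ n) w) ∈ S) → T v ∈ S := by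
    intro T hT
    have : S ≤ S.comap T := Submodule.span_le.2 (by rintro _ ⟨n, rfl⟩; exact hT n)
    exact this hv
  refine ⟨key E fun n => ?_, key F fun n => ?_, key H fun n => ?_⟩
  · cases n with
    | zero => rw [pow_zero, Module.End.one_apply, hE]; exact S.zero_mem
    | succ n => rw [raise_lower_pow hEF hHF hw hE]; exact S.smul_mem _ (hu n)
  · rw [← Module.End.mul_apply, ← pow_succ']; exact hu _
  · rw [weight_pow hHF hw]; exact S.smul_mem _ (hu n)

lemma raise_pow_eq_zero (hEF : ∀ v, E (F v) = F (E v) + H v)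
    (hHF : ∀ v, H (F v) = F (H v) + (-2 : ℂ) • F v) (hw : H w = c • w) (hE : E w = 0)
    {i n : ℕ} (h : i < n) : (E ^ n) ((F ^ i) w) = 0 := by
  induction i generalizing n with
  | zero =>
    obtain ⟨n, rfl⟩ := Nat.exists_eq_succ_of_ne_zero h.ne'
    rw [pow_succ, Module.End.mul_apply, pow_zero, Module.End.one_apply, hE, map_zero]
  | succ i ih =>
    obtain ⟨n, rfl⟩ := Nat.exists_eq_succ_of_ne_zero (Nat.ne_zero_of_lt h)
    rw [pow_succ, Module.End.mul_apply, raise_lower_pow hEF hHF hw hE, map_smul,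
      ih (by omega), smul_zero]

/-- The scalar is the product of the factors (i+1)(c − i) for i < n, none of which vanishes. -/
lemma exists_raise_pow_eq_smul (hEF : ∀ v, E (F v) = F (E v) + H v)
    (hHF : ∀ v, H (F v) = F (H v) + (-2 : ℂ) • F v) (hw : H w = c • w) (hE : E w = 0)
    (hc : ∀ n : ℕ, c ≠ n) (n : ℕ) : ∃ a : ℂ, a ≠ 0 ∧ (E ^ n) ((F ^ n) w) = a • w := by
  induction n with
  | zero => exact ⟨1, one_ne_zero, (one_smul ℂ w).symm⟩
  | succ n ih =>
    obtain ⟨a, ha, h⟩ := ih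
    refine ⟨(n + 1) * (c - n) * a, mul_ne_zero (mul_ne_zero (Nat.cast_add_one_ne_zero n)
      (sub_ne_zero.2 (hc n))) ha, ?_⟩
    rw [pow_succ E, Module.End.mul_apply, raise_lower_pow hEF hHF hw hE, map_smul, h, smul_smul]

lemma exists_mem_span_Iio (hspan : Submodule.span ℂ (Set.range fun n : ℕ => (F ^ n) w) = ⊤)
    (v : V) : ∃ n : ℕ, v ∈ Submodule.span ℂ ((fun n : ℕ => (F ^ n) w) '' Set.Iio n) := by
  have mono : ∀ {m n : ℕ}, m ≤ n → Submodule.span ℂ ((fun n : ℕ => (F ^ n) w) '' Set.Iio m) ≤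
      Submodule.span ℂ ((fun n : ℕ => (F ^ n) w) '' Set.Iio n) := fun h =>
    Submodule.span_mono (Set.image_mono (Set.Iio_subset_Iio h))
  have hv : v ∈ Submodule.span ℂ (Set.range fun n : ℕ => (F ^ n) w) := hspan ▸ Submodule.mem_top
  induction hv using Submodule.span_induction with
  | zero => exact ⟨0, Submodule.zero_mem _⟩
  | mem v hv =>
    obtain ⟨n, rfl⟩ := hv
    exact ⟨n + 1, Submodule.subset_span ⟨n, Nat.lt_succ_self n, rfl⟩⟩
  | add v v' _ _ h h' =>
    obtain ⟨n, hn⟩ := h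
    obtain ⟨n', hn'⟩ := h'
    exact ⟨max n n', Submodule.add_mem _ (mono (le_max_left _ _) hn) (mono (le_max_right _ _) hn')⟩
  | smul a v _ h =>
    obtain ⟨n, hn⟩ := h
    exact ⟨n, Submodule.smul_mem _ _ hn⟩

lemma raise_pow_eq_zero_of_mem_span (hEF : ∀ v, E (F v) = F (E v) + H v)
    (hHF : ∀ v, H (F v) = F (H v) + (-2 : ℂ) • F v) (hw : H w = c • w) (hE : E w = 0)
    {n : ℕ} {v : V}
    (hv : v ∈ Submodule.span ℂ ((fun n : ℕ => (F ^ n) w) '' Set.Iio n)) : (E ^ n) v = 0 := by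
  have : Submodule.span ℂ ((fun n : ℕ => (F ^ n) w) '' Set.Iio n) ≤ LinearMap.ker (E ^ n) := by
    rw [Submodule.span_le]
    rintro _ ⟨i, hi, rfl⟩
    exact raise_pow_eq_zero hEF hHF hw hE hi
  exact this hv

/-- A subspace of a Verma module of highest weight not in `ℕ` stable under raising and lowering is
trivial. -/
lemma eq_bot_or_eq_top_of_stable (hEF : ∀ v, E (F v) = F (E v) + H v)
    (hHF : ∀ v, H (F v) = F (H v) + (-2 : ℂ) • F v) (hw : H w = c • w) (hE : E w = 0)
    (hc : ∀ n : ℕ, c ≠ n) (hspan : Submodule.span ℂ (Set.range fun n : ℕ => (F ^ n) w) = ⊤)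
    {S : Submodule ℂ V} (hSE : ∀ v ∈ S, E v ∈ S) (hSF : ∀ v ∈ S, F v ∈ S) : S = ⊥ ∨ S = ⊤ := by
  by_cases hwS : w ∈ S
  · right
    rw [eq_top_iff, ← hspan, Submodule.span_le]
    rintro _ ⟨n, rfl⟩
    induction n with
    | zero => exact hwS
    | succ n ih =>
      change (F ^ (n + 1)) w ∈ S
      rw [pow_succ', Module.End.mul_apply]
      exact hSF _ ih
  · left
    rw [eq_bot_iff]
    intro v hv
    obtain ⟨n, hn⟩ := exists_mem_span_Iio hspan v
    induction n with
    | zero => simpa using hn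
    | succ n ih =>
      have hIio : Set.Iio (n + 1) = insert n (Set.Iio n) := by ext i; simp
      have hn' := hn
      rw [hIio, Set.image_insert_eq, Submodule.mem_span_insert] at hn'
      obtain ⟨a, z, hz, hvz⟩ := hn'
      have hpow : ∀ m : ℕ, (E ^ m) v ∈ S := by
        intro m
        induction m with
        | zero => exact hv
        | succ m ihm => rw [pow_succ', Module.End.mul_apply]; exact hSE _ ihm
      -- E^n kills the terms below F^n w and turns that one into a nonzero multiple of w. As w is
      -- not in S, the leading coefficient a vanishes and n decreases.
      obtain ⟨b, hb, hbw⟩ := exists_raise_pow_eq_smul hEF hHF hw hE hc n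
      have h := hpow n
      rw [hvz, map_add, map_smul, raise_pow_eq_zero_of_mem_span hEF hHF hw hE hz, add_zero, hbw,
        smul_smul] at h
      by_cases hab : a * b = 0
      · have ha : a = 0 := (mul_eq_zero.1 hab).resolve_right hb
        rw [ha, zero_smul, zero_add] at hvz
        exact ih (hvz ▸ hz)
      · exact absurd ((S.smul_mem_iff hab).1 h) hwS

end HighestWeight

/-! ### The highest and lowest weight Verma modules of `𝔰𝔩₂`. -/

section Verma

local notation "ι" => UniversalEnvelopingAlgebra.ι ℂ

variable {V : Type*} [AddCommGroup V] [Module ℂ V] (r : Sl2 →ₗ⁅ℂ⁆ Module.End ℂ V)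

lemma sl2_rep_rep (x y : Sl2) (v : V) : r x (r y v) = r y (r x v) + r ⁅x, y⁆ v := by
  rw [LieHom.map_lie, LieRing.of_associative_ring_bracket, LinearMap.sub_apply]
  exact (add_sub_cancel _ _).symm

lemma sl2_rep_e_f (v : V) : r eElt (r fElt v) = r fElt (r eElt v) + r hElt v := by
  rw [sl2_rep_rep, lie_e_f]

lemma sl2_rep_h_f (v : V) : r hElt (r fElt v) = r fElt (r hElt v) + (-2 : ℂ) • r fElt v := by
  rw [sl2_rep_rep, lie_h_f, ← neg_smul, map_smul, LinearMap.smul_apply]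

/-- With `sl2_rep_h_e`, this says that (f, e, −h) satisfies the relations used for (e, f, h). -/
lemma sl2_rep_f_e (v : V) : r fElt (r eElt v) = r eElt (r fElt v) + (-r hElt) v := by
  rw [sl2_rep_e_f, LinearMap.neg_apply]; abel

lemma sl2_rep_h_e (v : V) :
    (-r hElt) (r eElt v) = r eElt ((-r hElt) v) + (-2 : ℂ) • r eElt v := by
  rw [LinearMap.neg_apply, LinearMap.neg_apply, sl2_rep_rep, lie_h_e, map_smul,
    LinearMap.smul_apply, map_neg]
  module

lemma sl2_rep_mem {S : Submodule ℂ V} {v : V} (he : r eElt v ∈ S) (hf : r fElt v ∈ S)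
    (hh : r hElt v ∈ S) (x : Sl2) : r x v ∈ S := by
  rw [sl2_eq x, map_add, map_add, map_smul, map_smul, map_smul]
  exact S.add_mem (S.add_mem (S.smul_mem _ hh) (S.smul_mem _ he)) (S.smul_mem _ hf)

lemma span_eq_top_of_one_mem {B : LieSubalgebra ℂ Sl2} {χ : B →ₗ⁅ℂ⁆ Module.End ℂ ℂ}
    {S : Submodule ℂ (Ind B χ)} (h1 : Ind.of B χ 1 ∈ S)
    (h : ∀ x, ∀ v ∈ S, repOfModule Sl2 (Ind B χ) x v ∈ S) : S = ⊤ := by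
  have : (⊤ : Submodule _ (Ind B χ)) ≤ submoduleOfStable S h := by
    rw [← Ind.span_range_of, Submodule.span_le]
    rintro _ ⟨a, rfl⟩
    have ha : Ind.of B χ a = a • Ind.of B χ 1 := by rw [← map_smul, smul_eq_mul, mul_one]
    rw [ha]
    exact S.smul_mem a h1
  exact eq_top_iff.2 fun v _ => this (Submodule.mem_top : v ∈ ⊤)

/-- The generator of a Verma module of highest weight. -/
def vacPos (μ : Weight) : VermaPos μ := Ind.of borelPos (charPos μ) 1

/-- The generator of a Verma module of lowest weight. -/
def vacNeg (μ : Weight) : VermaNeg μ := Ind.of borelNeg (charNeg μ) 1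

lemma rep_vacPos (μ : Weight) :
    repOfModule Sl2 (VermaPos μ) eElt (vacPos μ) = 0 ∧
    repOfModule Sl2 (VermaPos μ) hElt (vacPos μ) = μ hCartan • vacPos μ := by
  obtain ⟨⟨h1, h2, h3⟩, ⟨e1, e2, e3⟩, f1, f2, f3⟩ := entry_basis
  refine ⟨(Ind.ι_smul_of (r := charPos μ) ⟨eElt, e3⟩ 1).trans ?_,
    (Ind.ι_smul_of (r := charPos μ) ⟨hElt, h3⟩ 1).trans ?_⟩
  · have : charPos μ ⟨eElt, e3⟩ 1 = 0 := by simp [charPos, e1]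
    rw [this, map_zero]
  · have : charPos μ ⟨hElt, h3⟩ 1 = μ hCartan • (1 : ℂ) := by simp [charPos, h1]
    rw [this, map_smul]; rfl

lemma rep_vacNeg (μ : Weight) :
    repOfModule Sl2 (VermaNeg μ) fElt (vacNeg μ) = 0 ∧
    repOfModule Sl2 (VermaNeg μ) hElt (vacNeg μ) = μ hCartan • vacNeg μ := by
  obtain ⟨⟨h1, h2, h3⟩, ⟨e1, e2, e3⟩, f1, f2, f3⟩ := entry_basis
  refine ⟨(Ind.ι_smul_of (r := charNeg μ) ⟨fElt, f2⟩ 1).trans ?_,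
    (Ind.ι_smul_of (r := charNeg μ) ⟨hElt, h2⟩ 1).trans ?_⟩
  · have : charNeg μ ⟨fElt, f2⟩ 1 = 0 := by simp [charNeg, f1]
    rw [this, map_zero]
  · have : charNeg μ ⟨hElt, h2⟩ 1 = μ hCartan • (1 : ℂ) := by simp [charNeg, h1]
    rw [this, map_smul]; rfl

lemma span_vermaPos (μ : Weight) : Submodule.span ℂ
    (Set.range fun n : ℕ => (repOfModule Sl2 (VermaPos μ) fElt ^ n) (vacPos μ)) = ⊤ := by
  obtain ⟨he, hh⟩ := rep_vacPos μ
  refine span_eq_top_of_one_mem (Submodule.subset_span ⟨0, rfl⟩) fun x v hv => ?_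
  obtain ⟨h1, h2, h3⟩ := span_pow_stable (sl2_rep_e_f _) (sl2_rep_h_f _) hh he hv
  exact sl2_rep_mem _ h1 h2 h3 x

lemma neg_h_vacNeg (μ : Weight) :
    (-repOfModule Sl2 (VermaNeg μ) hElt) (vacNeg μ) = (-μ hCartan) • vacNeg μ := by
  rw [LinearMap.neg_apply, (rep_vacNeg μ).2, neg_smul]

lemma span_vermaNeg (μ : Weight) : Submodule.span ℂ
    (Set.range fun n : ℕ => (repOfModule Sl2 (VermaNeg μ) eElt ^ n) (vacNeg μ)) = ⊤ := by
  refine span_eq_top_of_one_mem (Submodule.subset_span ⟨0, rfl⟩) fun x v hv => ?_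
  obtain ⟨h1, h2, h3⟩ := span_pow_stable (sl2_rep_f_e _) (sl2_rep_h_e _) (neg_h_vacNeg μ)
    (rep_vacNeg μ).1 hv
  exact sl2_rep_mem _ h2 h1 (neg_neg (repOfModule Sl2 (VermaNeg μ) hElt v) ▸
    Submodule.neg_mem _ h3) x

lemma irreducible_vermaPos {μ : Weight} (hμ : ∀ n : ℤ, μ hCartan ≠ n) :
    IsIrreducibleRep (repOfModule Sl2 (VermaPos μ)) := fun _ hS =>
  eq_bot_or_eq_top_of_stable (sl2_rep_e_f _) (sl2_rep_h_f _) (rep_vacPos μ).2 (rep_vacPos μ).1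
    (fun n => by exact_mod_cast hμ n) (span_vermaPos μ) (hS eElt) (hS fElt)

lemma irreducible_vermaNeg {μ : Weight} (hμ : ∀ n : ℤ, μ hCartan ≠ n) :
    IsIrreducibleRep (repOfModule Sl2 (VermaNeg μ)) := fun _ hS =>
  eq_bot_or_eq_top_of_stable (sl2_rep_f_e _) (sl2_rep_h_e _) (neg_h_vacNeg μ) (rep_vacNeg μ).1
    (fun n h => hμ (-n) (by push_cast; rw [← h, neg_neg])) (span_vermaNeg μ) (hS fElt) (hS eElt)

lemma e_nilpotent_vermaPos (μ : Weight) (m : VermaPos μ) :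
    ∃ n : ℕ, (repOfModule Sl2 (VermaPos μ) eElt ^ n) m = 0 :=
  (exists_mem_span_Iio (span_vermaPos μ) m).imp fun _ hn =>
    raise_pow_eq_zero_of_mem_span (sl2_rep_e_f _) (sl2_rep_h_f _) (rep_vacPos μ).2
      (rep_vacPos μ).1 hn

lemma f_nilpotent_vermaNeg (μ : Weight) (m : VermaNeg μ) :
    ∃ n : ℕ, (repOfModule Sl2 (VermaNeg μ) fElt ^ n) m = 0 :=
  (exists_mem_span_Iio (span_vermaNeg μ) m).imp fun _ hn =>
    raise_pow_eq_zero_of_mem_span (sl2_rep_f_e _) (sl2_rep_h_e _) (neg_h_vacNeg μ)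
      (rep_vacNeg μ).1 hn

end Verma

/-! ### The structure of dense modules -/

section Dense

lemma weight_ext {μ ν : Weight} (h : μ hCartan = ν hCartan) : μ = ν := by
  refine LinearMap.ext fun ⟨x, hx⟩ => ?_
  obtain ⟨a, rfl⟩ := Submodule.mem_span_singleton.1 hx
  have : (⟨a • hElt, hx⟩ : Cartan) = a • hCartan := rfl
  rw [this, map_smul, map_smul, h]

lemma exists_shift_eq {lam : Weight ⧸ rootLattice}
    (μ ν : {μ : Weight // (μ : Weight ⧸ rootLattice) = lam}) : ∃ j : ℤ, ν = shift j μ := by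
  have h : (μ.1 : Weight ⧸ rootLattice) = ν.1 := μ.2.trans ν.2.symm
  rw [QuotientAddGroup.eq] at h
  obtain ⟨j, hj⟩ := AddSubgroup.mem_zmultiples_iff.1 h
  refine ⟨j, Subtype.ext ?_⟩
  change ν.1 = μ.1 + j • simpleRoot
  rw [hj]; abel

variable {lam : Weight ⧸ rootLattice} {q : ℂ}
  (μ : {μ : Weight // (μ : Weight ⧸ rootLattice) = lam})

/-- The basis vector `v_{μ + j α}` of the dense module. -/
def denseVec (j : ℤ) : Dense lam := Finsupp.single (shift j μ) 1

lemma denseRep_f (j : ℤ) : denseRep lam q fElt (denseVec μ j) = denseVec μ (j - 1) := by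
  obtain ⟨-, -, f1, f2, f3⟩ := entry_basis
  simp [denseRep, f1, f2, f3, denseVec, denseF, shift_shift, sub_eq_add_neg]

lemma denseRep_h (j : ℤ) :
    denseRep lam q hElt (denseVec μ j) = (μ.1 hCartan + 2 * j) • denseVec μ j := by
  obtain ⟨⟨h1, h2, h3⟩, -⟩ := entry_basis
  simp [denseRep, h1, h2, h3, denseVec, denseH, bilin_root, shift_h]

/-- The quadratic j ↦ γ_{μ+jα} has the root 0 by the choice of q; its other root −μ(h) − 1 is the
Weyl reflection fixing ρ-shifted norms, and is an integer only if μ(h) is. -/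
lemma denseRep_e (hμ : bilin μ.1 (μ.1 + (2 : ℂ) • weylVector) = q) (j : ℤ) :
    denseRep lam q eElt (denseVec μ j) =
      (-(j * (μ.1 hCartan + j + 1)) : ℂ) • denseVec μ (j + 1) := by
  obtain ⟨-, ⟨e1, e2, e3⟩, -⟩ := entry_basis
  have : gammaCoeff q (shift j μ).1 = -(j * (μ.1 hCartan + j + 1)) := by
    rw [gammaCoeff, ← hμ, bilin_rho, bilin_rho, shift_h]
    ring
  simp [denseRep, e1, e2, e3, denseVec, denseE, shift_shift, this]

lemma span_denseVec : Submodule.span ℂ (Set.range (denseVec μ)) = ⊤ := by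
  refine eq_top_iff.2 fun v _ => ?_
  induction v using Finsupp.induction_linear with
  | zero => exact Submodule.zero_mem _
  | add v w hv hw => exact Submodule.add_mem _ (hv trivial) (hw trivial)
  | single ν a =>
    obtain ⟨j, rfl⟩ := exists_shift_eq μ ν
    have : Finsupp.single (shift j μ) a = a • denseVec μ j := by simp [denseVec]
    rw [this]
    exact Submodule.smul_mem _ _ (Submodule.subset_span ⟨j, rfl⟩)

lemma iSup_denseRep_h :
    ⨆ j : ℤ, (denseRep lam q hElt).eigenspace (μ.1 hCartan + 2 * j) = ⊤ := by
  rw [eq_top_iff, ← span_denseVec μ, Submodule.span_le]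
  rintro _ ⟨j, rfl⟩
  exact Submodule.mem_iSup_of_mem j (Module.End.mem_eigenspace_iff.2 (denseRep_h μ j))

/-- The representation on the quotient by a stable subspace. -/
def quotientRep {V : Type*} [AddCommGroup V] [Module ℂ V] (r : Sl2 →ₗ⁅ℂ⁆ Module.End ℂ V)
    (S : Submodule ℂ V) (hS : ∀ x, ∀ v ∈ S, r x v ∈ S) : Sl2 →ₗ⁅ℂ⁆ Module.End ℂ (V ⧸ S) where
  toFun x := S.mapQ S (r x) (hS x)
  map_add' x y := by
    ext v
    simp
  map_smul' a x := by
    ext v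
    simp
  map_lie' := by
    intro x y
    ext v
    simp [LieRing.of_associative_ring_bracket]

lemma quotientRep_mkQ {V : Type*} [AddCommGroup V] [Module ℂ V] (r : Sl2 →ₗ⁅ℂ⁆ Module.End ℂ V)
    (S : Submodule ℂ V) (hS : ∀ x, ∀ v ∈ S, r x v ∈ S) (x : Sl2) (v : V) :
    quotientRep r S hS x (S.mkQ v) = S.mkQ (r x v) := rfl

lemma rep_borelPos {V : Type*} [AddCommGroup V] [Module ℂ V] (r : Sl2 →ₗ⁅ℂ⁆ Module.End ℂ V)
    {ν : Weight} {v : V} (he : r eElt v = 0) (hh : r hElt v = ν hCartan • v) (b : borelPos)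
    (a : ℂ) :
    LinearMap.toSpanSingleton ℂ V v (charPos ν b a) =
      r b (LinearMap.toSpanSingleton ℂ V v a) := by
  have hb : entry 1 0 (b : Sl2) = 0 := b.2
  conv_rhs => rw [sl2_eq (b : Sl2), hb]
  simp [charPos, he, hh, smul_smul]
  ring_nf

lemma rep_borelNeg {V : Type*} [AddCommGroup V] [Module ℂ V] (r : Sl2 →ₗ⁅ℂ⁆ Module.End ℂ V)
    {ν : Weight} {v : V} (hf : r fElt v = 0) (hh : r hElt v = ν hCartan • v) (b : borelNeg)
    (a : ℂ) :
    LinearMap.toSpanSingleton ℂ V v (charNeg ν b a) =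
      r b (LinearMap.toSpanSingleton ℂ V v a) := by
  have hb : entry 0 1 (b : Sl2) = 0 := b.2
  conv_rhs => rw [sl2_eq (b : Sl2), hb]
  simp [charNeg, hf, hh, smul_smul]
  ring_nf

lemma exists_map_vermaPos {V : Type*} [AddCommGroup V] [Module ℂ V]
    (r : Sl2 →ₗ⁅ℂ⁆ Module.End ℂ V) {ν : Weight} {v : V} (he : r eElt v = 0)
    (hh : r hElt v = ν hCartan • v) : ∃ φ : VermaPos ν →ₗ[ℂ] V,
      (∀ x m, φ (repOfModule Sl2 (VermaPos ν) x m) = r x (φ m)) ∧ φ (vacPos ν) = v :=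
  ⟨Ind.liftRep r (LinearMap.toSpanSingleton ℂ V v) (rep_borelPos r he hh),
    Ind.liftRep_ι_smul _ _ _, (Ind.liftRep_of _ _ _ _).trans (one_smul _ _)⟩

lemma exists_map_vermaNeg {V : Type*} [AddCommGroup V] [Module ℂ V]
    (r : Sl2 →ₗ⁅ℂ⁆ Module.End ℂ V) {ν : Weight} {v : V} (hf : r fElt v = 0)
    (hh : r hElt v = ν hCartan • v) : ∃ φ : VermaNeg ν →ₗ[ℂ] V,
      (∀ x m, φ (repOfModule Sl2 (VermaNeg ν) x m) = r x (φ m)) ∧ φ (vacNeg ν) = v :=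
  ⟨Ind.liftRep r (LinearMap.toSpanSingleton ℂ V v) (rep_borelNeg r hf hh),
    Ind.liftRep_ι_smul _ _ _, (Ind.liftRep_of _ _ _ _).trans (one_smul _ _)⟩

lemma IsIrreducibleRep.injective {V V' : Type*} [AddCommGroup V] [Module ℂ V] [AddCommGroup V']
    [Module ℂ V'] {r : Sl2 →ₗ⁅ℂ⁆ Module.End ℂ V} {r' : Sl2 →ₗ⁅ℂ⁆ Module.End ℂ V'}
    (hr : IsIrreducibleRep r) {φ : V →ₗ[ℂ] V'} (hφ : ∀ x m, φ (r x m) = r' x (φ m)) {v : V}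
    (hv : φ v ≠ 0) : Function.Injective φ := by
  rw [← LinearMap.ker_eq_bot]
  refine (hr (LinearMap.ker φ) fun x m hm => ?_).resolve_right fun h => hv ?_
  · rw [LinearMap.mem_ker] at hm ⊢
    rw [hφ, hm, map_zero]
  · exact LinearMap.mem_ker.1 (h ▸ Submodule.mem_top)

/-- The decomposition of a dense module into Verma modules of highest and of lowest weight. -/
theorem dense_exact_sequence (hμ : bilin μ.1 (μ.1 + (2 : ℂ) • weylVector) = q)
    (hint : ∀ n : ℤ, μ.1 hCartan ≠ n) :
    ∃ (φ : VermaPos μ.1 →ₗ[ℂ] Dense lam) (ψ : Dense lam →ₗ[ℂ] VermaNeg (μ.1 + simpleRoot)),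
      (∀ x m, φ (repOfModule Sl2 (VermaPos μ.1) x m) = denseRep lam q x (φ m)) ∧
      (∀ x m, ψ (denseRep lam q x m) = repOfModule Sl2 (VermaNeg (μ.1 + simpleRoot)) x (ψ m)) ∧
      Function.Injective φ ∧ Function.Surjective ψ ∧ (∀ m, ψ m = 0 ↔ m ∈ LinearMap.range φ) ∧
      Nontrivial (VermaPos μ.1) ∧ Nontrivial (VermaNeg (μ.1 + simpleRoot)) := by
  obtain ⟨φ, hφ, hφv⟩ := exists_map_vermaPos (denseRep lam q) (ν := μ.1) (v := denseVec μ 0)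
    (by rw [denseRep_e μ hμ]; simp) (by rw [denseRep_h]; simp)
  have hvec : ∀ j, denseVec μ j ≠ 0 := fun j => by simp [denseVec]
  have hφinj := (irreducible_vermaPos hint).injective hφ (hφv ▸ hvec 0)
  have hpow : ∀ n : ℕ, φ ((repOfModule Sl2 (VermaPos μ.1) fElt ^ n) (vacPos μ.1)) =
      denseVec μ (-n) := by
    intro n
    induction n with
    | zero => simpa using hφv
    | succ n ih =>
      rw [pow_succ', Module.End.mul_apply, hφ, ih, denseRep_f]
      congr 1
      push_cast; ring
  set A := LinearMap.range φ with hA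
  have hAx : ∀ x, ∀ v ∈ A, denseRep lam q x v ∈ A := by
    rintro x _ ⟨m, rfl⟩
    exact ⟨_, hφ x m⟩
  have hmem : ∀ n : ℕ, denseVec μ (-n) ∈ A := fun n => ⟨_, hpow n⟩
  -- The image A is spanned by v_{μ−nα} with n ≥ 0, so the coordinate at μ + α vanishes on it.
  have hnot : denseVec μ 1 ∉ A := by
    have hle : A ≤ LinearMap.ker (Finsupp.lapply (shift 1 μ) : Dense lam →ₗ[ℂ] ℂ) := by
      rw [hA, LinearMap.range_eq_map, ← span_vermaPos, Submodule.map_span, Submodule.span_le]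
      rintro _ ⟨_, ⟨n, rfl⟩, rfl⟩
      change φ ((repOfModule Sl2 (VermaPos μ.1) fElt ^ n) (vacPos μ.1)) ∈ _
      rw [hpow, SetLike.mem_coe, LinearMap.mem_ker, Finsupp.lapply_apply, denseVec]
      refine Finsupp.single_eq_of_ne fun h => ?_
      have h1 := congrArg (fun ν => ν.1 hCartan) h
      simp only [shift_h] at h1
      have h2 : ((n + 1 : ℕ) : ℂ) = 0 := by
        push_cast at h1 ⊢
        linear_combination h1 / 2
      exact Nat.succ_ne_zero n (Nat.cast_eq_zero.1 h2)
    intro h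
    have := LinearMap.mem_ker.1 (hle h)
    simp [denseVec] at this
  have hint' : ∀ n : ℤ, (μ.1 + simpleRoot) hCartan ≠ n := by
    intro n hn
    rw [LinearMap.add_apply, simpleRoot_h] at hn
    refine hint (n - 2) ?_
    push_cast
    linear_combination hn
  -- The universal property only gives maps out of a Verma module, so ψ is built backwards: χ maps
  -- to the quotient by A, where v_{μ+α} is a lowest weight vector because f v_{μ+α} = v_μ lies in
  -- A.
  obtain ⟨χ, hχ, hχv⟩ := exists_map_vermaNeg (quotientRep (denseRep lam q) A hAx)
    (ν := μ.1 + simpleRoot) (v := A.mkQ (denseVec μ 1))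
    (by
      rw [quotientRep_mkQ, denseRep_f]
      exact (Submodule.Quotient.mk_eq_zero A).2 (by simpa using hmem 0))
    (by
      rw [quotientRep_mkQ, denseRep_h, map_smul, LinearMap.add_apply, simpleRoot_h]
      simp)
  have hχ0 : χ (vacNeg (μ.1 + simpleRoot)) ≠ 0 := by
    rw [hχv]
    exact fun h => hnot ((Submodule.Quotient.mk_eq_zero A).1 h)
  have hχinj := (irreducible_vermaNeg hint').injective hχ hχ0
  have hpos : ∀ n : ℕ, A.mkQ (denseVec μ (n + 1)) ∈ LinearMap.range χ := by
    intro n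
    induction n with
    | zero => exact ⟨_, by simpa using hχv⟩
    | succ n ih =>
      obtain ⟨m, hm⟩ := ih
      have h := hχ eElt m
      rw [hm, quotientRep_mkQ, denseRep_e μ hμ, map_smul] at h
      -- The coefficient of e at j = n + 1. Being nonzero, it lets e climb from v_{μ+α} to every
      -- v_{μ+jα} with j > 0.
      have hne : (-((n + 1 : ℤ) * (μ.1 hCartan + (n + 1 : ℤ) + 1)) : ℂ) ≠ 0 := by
        refine neg_ne_zero.2 (mul_ne_zero (by exact_mod_cast Nat.succ_ne_zero n) fun h0 => ?_)
        refine hint (-(n + 2)) ?_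
        push_cast at h0 ⊢
        linear_combination h0
      have h' : A.mkQ (denseVec μ (n + 1 + 1)) ∈ LinearMap.range χ :=
        ((LinearMap.range χ).smul_mem_iff hne).1 ⟨_, by exact_mod_cast h⟩
      exact_mod_cast h'
  have hχsurj : Function.Surjective χ := by
    rw [← LinearMap.range_eq_top, eq_top_iff, ← A.range_mkQ, LinearMap.range_eq_map,
      ← span_denseVec μ, Submodule.map_span, Submodule.span_le]
    rintro _ ⟨_, ⟨j, rfl⟩, rfl⟩
    rcases le_or_gt j 0 with hj | hj
    · obtain ⟨n, rfl⟩ : ∃ n : ℕ, j = -n := ⟨(-j).toNat, by omega⟩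
      rw [show A.mkQ (denseVec μ (-n)) = 0 from (Submodule.Quotient.mk_eq_zero A).2 (hmem n)]
      exact Submodule.zero_mem _
    · obtain ⟨n, rfl⟩ : ∃ n : ℕ, j = n + 1 := ⟨(j - 1).toNat, by omega⟩
      exact hpos n
  let e := LinearEquiv.ofBijective χ ⟨hχinj, hχsurj⟩
  refine ⟨φ, e.symm.toLinearMap.comp A.mkQ, hφ, fun x m => ?_, hφinj,
    e.symm.surjective.comp A.mkQ_surjective, fun m => ?_, ⟨vacPos μ.1, 0, fun h => ?_⟩,
    ⟨vacNeg (μ.1 + simpleRoot), 0, fun h => ?_⟩⟩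
  · change e.symm (A.mkQ _) = repOfModule Sl2 (VermaNeg (μ.1 + simpleRoot)) x (e.symm (A.mkQ m))
    rw [LinearEquiv.symm_apply_eq]
    refine Eq.trans ?_ (hχ x (e.symm (A.mkQ m))).symm
    rw [show χ (e.symm (A.mkQ m)) = A.mkQ m from e.apply_symm_apply _, quotientRep_mkQ]
  · change e.symm (A.mkQ m) = 0 ↔ _
    rw [LinearEquiv.map_eq_zero_iff]
    exact Submodule.Quotient.mk_eq_zero A
  · rw [h, map_zero] at hφv
    exact hvec 0 hφv.symm
  · rw [h, map_zero] at hχ0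
    exact hχ0 rfl

end Dense

end RelaxedSl2

end

/-! ### The proposition. -/

theorem mainTheorem5 (k Δ q : ℂ)
    (hq : ∀ s : ℂ, s ^ 2 = 1 + 2 * q → ∀ n : ℤ, s ≠ (n : ℂ))
    (lam : RelaxedSl2.Weight ⧸ RelaxedSl2.rootLattice)
    (hlam : lam ∈ RelaxedSl2.nonSimpleSet q) :
    (∃! μ : RelaxedSl2.Weight, (μ : RelaxedSl2.Weight ⧸ RelaxedSl2.rootLattice) = lam ∧
      RelaxedSl2.bilin μ (μ + (2 : ℂ) • RelaxedSl2.weylVector) = q) ∧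
    ∀ μ : RelaxedSl2.Weight, (μ : RelaxedSl2.Weight ⧸ RelaxedSl2.rootLattice) = lam →
      RelaxedSl2.bilin μ (μ + (2 : ℂ) • RelaxedSl2.weylVector) = q →
      ∃ (i : RelaxedSl2.SimplePos k Δ μ →ₗ[RelaxedSl2.UAffine] RelaxedSl2.RelaxedE k Δ lam q)
        (p : RelaxedSl2.RelaxedE k Δ lam q →ₗ[RelaxedSl2.UAffine]
          RelaxedSl2.SimpleNeg k Δ (μ + RelaxedSl2.simpleRoot)),
        Function.Injective i ∧ Function.Exact i p ∧ Function.Surjective p := by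
  -- The number μ(h) + 1 is a square root of 1 + 2q.
  have hint : ∀ μ : RelaxedSl2.Weight,
      RelaxedSl2.bilin μ (μ + (2 : ℂ) • RelaxedSl2.weylVector) = q →
      ∀ n : ℤ, μ RelaxedSl2.hCartan ≠ n := by
    intro μ hμ n hn
    rw [RelaxedSl2.bilin_rho, hn] at hμ
    refine hq ((n + 1 : ℤ) : ℂ) ?_ (n + 1) rfl
    push_cast
    linear_combination 2 * hμ
  refine ⟨?_, ?_⟩
  · obtain ⟨μ, hμ, hμq⟩ := hlam
    refine ⟨μ, ⟨hμ, hμq⟩, ?_⟩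
    rintro ν ⟨hν, hνq⟩
    obtain ⟨j, hj⟩ := RelaxedSl2.exists_shift_eq ⟨μ, hμ⟩ ⟨ν, hν⟩
    have hνj := RelaxedSl2.shift_h j ⟨μ, hμ⟩
    rw [← hj] at hνj
    change ν RelaxedSl2.hCartan = μ RelaxedSl2.hCartan + 2 * j at hνj
    have h := hνq.trans hμq.symm
    rw [RelaxedSl2.bilin_rho, RelaxedSl2.bilin_rho, hνj] at h
    -- The second factor corresponds to the other solution −μ − 2ρ, which lies in the coset of μ
    -- only if μ(h) is an integer.
    have h' : (j : ℂ) * (μ RelaxedSl2.hCartan + j + 1) = 0 := by linear_combination h / 2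
    rcases mul_eq_zero.1 h' with h0 | h0
    · exact RelaxedSl2.weight_ext (by rw [hνj, h0, mul_zero, add_zero])
    · refine absurd ?_ (hint μ hμq (-j - 1))
      push_cast
      linear_combination h0
  · intro μ hμ hμq
    obtain ⟨φ, ψ, hφ, hψ, hinj, hsurj, hexact, hn, hn'⟩ :=
      RelaxedSl2.dense_exact_sequence ⟨μ, hμ⟩ hμq (hint μ hμq)
    have hint' : ∀ n : ℤ, (μ + RelaxedSl2.simpleRoot) RelaxedSl2.hCartan ≠ n := by
      intro n hn
      rw [LinearMap.add_apply, RelaxedSl2.simpleRoot_h] at hn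
      refine hint μ hμq (n - 2) ?_
      push_cast
      linear_combination hn
    -- Here c = μ(h), and `trivialIntersection` unfolds to the `radical` of `denseRep`.
    exact RelaxedSl2.exists_exact_sequence (RelaxedSl2.irreducible_vermaPos (hint μ hμq))
      (RelaxedSl2.irreducible_vermaNeg hint') hinj hsurj hexact hφ hψ
      (RelaxedSl2.e_nilpotent_vermaPos μ) (RelaxedSl2.f_nilpotent_vermaNeg _) (hint μ hμq)
      (RelaxedSl2.iSup_denseRep_h ⟨μ, hμ⟩) k Δ
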